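/- Let $X$ be a compact complex manifold. Write $A^{a,b}=A^{a,b}(X)$ for the smooth complex-valued $(a,b)$-forms, $A^k=\bigoplus_{a+b=k}A^{a,b}$, $d=\partial+\bar\partial$, and $F^pA^k=\bigoplus_{a\ge p}A^{a,k-a}$. The Frölicher spectral sequence is the spectral sequence of the filtered complex $(F^\bullet A^\bullet,d)$: with $Z_r^{p,q}=F^pA^{p+q}\cap d^{-1}(F^{p+r}A^{p+q+1})$ and $B_r^{p,q}=F^pA^{p+q}\cap d(F^{p-r}A^{p+q-1})$, set $E_r^{p,q}=Z_r^{p,q}/(Z_{r-1}^{p+1,q-1}+B_{r-1}^{p,q})$ for $r\ge 1$, and let $d_r^{p,q}\colon E_r^{p,q}\to E_r^{p+r,q-r+1}$ be the map induced by $d$. Let $p,q\ge 0$ and suppose that $d_r^{p,q}=0$ for all $r\ge1$, and that $d_r^{p-1-i,\,q+1+i}=0$ for all $r\ge 1$ and all $0\le i\le r-1$. Let $N\ge0$, $t=(t_1,\dots,t_m)$, and let $\phi=\phi(t)=\sum_{i=1}^N\phi_i$, where $\phi_i$ is a homogeneous polynomial of degree $i$ in $t$ with coefficients in $A^{0,1}(X,T^{1,0})$,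 such that $$\bar\partial\phi=\tfrac12[\phi,\phi]\quad\text{mod } t^{N+1},$$ where, for $\phi=\sum_j\phi^j\otimes\frac{\partial}{\partial z^j}$ and $\psi=\sum_j\psi^j\otimes\frac{\partial}{\partial z^j}$ in local holomorphic coordinates, $\bar\partial\phi=\sum_j\bar\partial\phi^j\otimes\frac{\partial}{\partial z^j}$ and $[\phi,\psi]=\sum_{i,j}(\phi^i\wedge\partial_i\psi^j+\psi^i\wedge\partial_i\phi^j)\otimes\frac{\partial}{\partial z^j}$. Let $i_\phi$ be the contraction $i_\phi\alpha=\sum_j\phi^j\wedge(\frac{\partial}{\partial z^j}\lrcorner\,\alpha)$ and $e^{i_\phi}=\sum_{k\ge0}\frac1{k!}(i_\phi)^k$. Here "mod $t^{N+1}$" means that all homogeneous components of degree $\le N$ in $t$ agree. Then for every $\alpha_0\in A^{p,q}(X)$ with $\bar\partial\alpha_0=0$ there is a polynomial $\alpha(t)=\sum_{k=0}^N\alpha_k$, with $\alpha_k$ homogeneous of degree $k$ in $t$ with coefficients in $F^pA^{p+q}(X)$, such that $$d\bigl(e^{i_\phi}(\alpha(t))\bigr)=0\ \text{ mod } t^{N+1},\qquad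 \alpha(0)^{p,q}=\alpha_0,$$ where $\alpha(0)^{p,q}$ denotes the $(p,q)$-component of $\alpha(0)$. -/

import Mathlib

open scoped Manifold ContDiff Topology

noncomputable section

namespace CplxForms

/-! ### Linear algebra on one (real) tangent space

`E` is a complex vector space, regarded as the real tangent space of a complex manifold at a point,
multiplication by `Complex.I` being the complex structure. Complex valued `k`-forms at the point are
the real-multilinear alternating maps `E [⋀^Fin k]→L[ℝ] ℂ`. -/

section Pointwise

theorem contDiff_fderivCompId {E F : Type*} [NormedAddCommGroup E] [NormedSpace ℝ E]
    [NormedAddCommGroup F] [NormedSpace ℝ F] (k : ℕ) :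
    ContDiff ℝ ∞ (fun η : E [⋀^Fin k]→L[ℝ] F =>
      η.fderivCompContinuousLinearMap (ContinuousLinearMap.id ℝ E)) :=
  (ContinuousAlternatingMap.fderivCompContinuousLinearMapCLM (𝕜 := ℝ) (ι := Fin k) F
    (ContinuousLinearMap.id ℝ E)).contDiff

variable {E : Type*} [NormedAddCommGroup E] [NormedSpace ℂ E]

/-- Multiplication by a complex number, as a real-linear map. -/
def mulCLM (E : Type*) [NormedAddCommGroup E] [NormedSpace ℂ E] (c : ℂ) : E →L[ℝ] E :=
  c • ContinuousLinearMap.id ℝ E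

/-- A form is of type `(a, b)` if `η(c v₁, …, c vₖ) = cᵃ c̄ᵇ η(v₁, …, vₖ)` for all `c : ℂ`.
(Taking `c` real one sees that only the zero form has type `(a, b)` if `a + b ≠ k`.) -/
def HasType {k : ℕ} (a b : ℕ) (η : E [⋀^Fin k]→L[ℝ] ℂ) : Prop :=
  ∀ (c : ℂ) (v : Fin k → E), η (fun j => c • v j) = c ^ a * (starRingEnd ℂ c) ^ b * η v

/-- A primitive root of unity of order `2 k + 1`. -/
def rootU (k : ℕ) : ℂ := Complex.exp (2 * Real.pi * Complex.I / ((2 * k + 1 : ℕ) : ℂ))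

/-- The projection of a `k`-form to its component of type `(a, b)`, for `a + b = k`, written as a
discrete Fourier coefficient of the action `η ↦ η(c v₁, …, c vₖ)` of complex numbers of modulus one:
a form of type `(a', b')` is multiplied by `c ^ (a' - b')` under this action, and the integers
`a' - b'` with `a' + b' = k` are distinct modulo `2 k + 1`. It is zero for `a + b ≠ k`. -/
def typeProj {k : ℕ} (a b : ℕ) (η : E [⋀^Fin k]→L[ℝ] ℂ) : E [⋀^Fin k]→L[ℝ] ℂ :=
  if a + b = k then
    ((2 * k + 1 : ℕ) : ℂ)⁻¹ • ∑ j ∈ Finset.range (2 * k + 1),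
      ((rootU k ^ j) ^ ((b : ℤ) - (a : ℤ))) •
        η.compContinuousLinearMap (mulCLM E (rootU k ^ j))
  else 0

/-- The derivation of degree `0` of the algebra of forms induced by an endomorphism `A`:
`(v₁, …, vₖ) ↦ ∑ⱼ η(v₁, …, A vⱼ, …, vₖ)`. -/
def derAct {k : ℕ} (A : E →L[ℝ] E) (η : E [⋀^Fin k]→L[ℝ] ℂ) : E [⋀^Fin k]→L[ℝ] ℂ :=
  η.fderivCompContinuousLinearMap (ContinuousLinearMap.id ℝ E) A

theorem derAct_apply {k : ℕ} (A : E →L[ℝ] E) (η : E [⋀^Fin k]→L[ℝ] ℂ) (v : Fin k → E) :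
    derAct A η v = ∑ j, η (Function.update v j (A (v j))) := by
  rw [derAct, ContinuousAlternatingMap.fderivCompContinuousLinearMap_apply]
  refine Finset.sum_congr rfl fun i _ => congrArg _ ?_
  funext j
  by_cases h : j = i
  · subst h; simp
  · simp [h]

/-- Contraction `i_φ η` of a form with a `T^{1,0}`-valued `1`-form `φ`. The value `φ(v)`, a vector of
type `(1,0)`, is recorded as the real tangent vector `w` with `φ(v) = (w - i J w) / 2`, so that
`(i_φ η)(v₁, …, vₖ) = ∑ⱼ η(v₁, …, φ(vⱼ), …, vₖ)`, with `η` extended complex-multilinearly,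
becomes the expression below. -/
def contrPt {k : ℕ} (A : E →L[ℝ] E) (η : E [⋀^Fin k]→L[ℝ] ℂ) : E [⋀^Fin k]→L[ℝ] ℂ :=
  (1 / 2 : ℂ) • (derAct A η - Complex.I • derAct (Complex.I • A) η)

theorem contrPt_apply {k : ℕ} (A : E →L[ℝ] E) (η : E [⋀^Fin k]→L[ℝ] ℂ) (v : Fin k → E) :
    contrPt A η v = ∑ j, (1 / 2 : ℂ) * (η (Function.update v j (A (v j))) -
      Complex.I * η (Function.update v j (Complex.I • A (v j)))) := by
  simp only [contrPt, ContinuousAlternatingMap.smul_apply, ContinuousAlternatingMap.sub_apply,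
    derAct_apply, smul_eq_mul, smul_apply]
  rw [Finset.mul_sum, ← Finset.sum_sub_distrib, Finset.mul_sum]

theorem derAct_add {k : ℕ} (A : E →L[ℝ] E) (η ξ : E [⋀^Fin k]→L[ℝ] ℂ) :
    derAct A (η + ξ) = derAct A η + derAct A ξ := by
  ext v; simp [derAct_apply, Finset.sum_add_distrib]

theorem derAct_smul {k : ℕ} (A : E →L[ℝ] E) (c : ℂ) (η : E [⋀^Fin k]→L[ℝ] ℂ) :
    derAct A (c • η) = c • derAct A η := by
  ext v; simp [derAct_apply, Finset.mul_sum]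

theorem contrPt_add {k : ℕ} (A : E →L[ℝ] E) (η ξ : E [⋀^Fin k]→L[ℝ] ℂ) :
    contrPt A (η + ξ) = contrPt A η + contrPt A ξ := by
  simp only [contrPt, derAct_add]; module

theorem contrPt_smul {k : ℕ} (A : E →L[ℝ] E) (c : ℂ) (η : E [⋀^Fin k]→L[ℝ] ℂ) :
    contrPt A (c • η) = c • contrPt A η := by
  simp only [contrPt, derAct_smul]; module

theorem typeProj_apply {k : ℕ} {a b : ℕ} (hk : a + b = k) (η : E [⋀^Fin k]→L[ℝ] ℂ)
    (v : Fin k → E) : typeProj a b η v = ((2 * k + 1 : ℕ) : ℂ)⁻¹ *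
      ∑ j ∈ Finset.range (2 * k + 1),
        ((rootU k ^ j) ^ ((b : ℤ) - (a : ℤ))) * η (fun i => rootU k ^ j • v i) := by
  rw [typeProj, if_pos hk, ContinuousAlternatingMap.smul_apply,
    ContinuousAlternatingMap.sum_apply, smul_eq_mul]
  rfl

theorem typeProj_add {k : ℕ} (a b : ℕ) (η ξ : E [⋀^Fin k]→L[ℝ] ℂ) :
    typeProj a b (η + ξ) = typeProj a b η + typeProj a b ξ := by
  by_cases hk : a + b = k
  · ext v
    simp only [typeProj_apply hk, ContinuousAlternatingMap.add_apply, mul_add,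
      Finset.sum_add_distrib]
  · simp [typeProj, hk]

theorem typeProj_smul {k : ℕ} (a b : ℕ) (c : ℂ) (η : E [⋀^Fin k]→L[ℝ] ℂ) :
    typeProj a b (c • η) = c • typeProj a b η := by
  by_cases hk : a + b = k
  · ext v
    simp only [typeProj_apply hk, ContinuousAlternatingMap.smul_apply, smul_eq_mul,
      mul_left_comm _ c, ← Finset.mul_sum]
  · simp only [typeProj, hk, if_false]; module

theorem rootU_pow (k : ℕ) : IsPrimitiveRoot (rootU k) (2 * k + 1) :=
  Complex.isPrimitiveRoot_exp (2 * k + 1) (by omega)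

/-- The action of a power of the root of unity on a form of type `(a, b)`. -/
theorem HasType.comp_root {k : ℕ} {a b : ℕ} {η : E [⋀^Fin k]→L[ℝ] ℂ} (h : HasType a b η) (j : ℕ) :
    η.compContinuousLinearMap (mulCLM E (rootU k ^ j)) =
      ((rootU k ^ j) ^ ((a : ℤ) - (b : ℤ))) • η := by
  have h0 : rootU k ≠ 0 := Complex.exp_ne_zero _
  have hn : ‖rootU k ^ j‖ = 1 := by
    rw [norm_pow, (rootU_pow k).norm'_eq_one (by omega), one_pow]
  ext v
  have := h (rootU k ^ j) v
  have hc : (starRingEnd ℂ) (rootU k ^ j) = (rootU k ^ j)⁻¹ := by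
    rw [Complex.inv_def, Complex.normSq_eq_norm_sq, hn]; simp
  rw [hc] at this
  simp only [ContinuousAlternatingMap.smul_apply, smul_eq_mul]
  rw [zpow_sub₀ (pow_ne_zero _ h0), zpow_natCast, zpow_natCast, div_eq_mul_inv, ← inv_pow]
  exact this

theorem typeProj_of_hasType {k : ℕ} {a b : ℕ} (hk : a + b = k) {η : E [⋀^Fin k]→L[ℝ] ℂ}
    (h : HasType a b η) : typeProj a b η = η := by
  have h0 : rootU k ≠ 0 := Complex.exp_ne_zero _
  have h2 : ((2 * k + 1 : ℕ) : ℂ) ≠ 0 := by exact_mod_cast (by omega : 2 * k + 1 ≠ 0)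
  rw [typeProj, if_pos hk]
  have : ∀ j ∈ Finset.range (2 * k + 1), ((rootU k ^ j) ^ ((b : ℤ) - (a : ℤ))) •
        η.compContinuousLinearMap (mulCLM E (rootU k ^ j)) = η := by
    intro j _
    rw [h.comp_root, smul_smul, ← zpow_add₀ (pow_ne_zero _ h0)]
    simp
  rw [Finset.sum_congr rfl this, Finset.sum_const, Finset.card_range,
    ← Nat.cast_smul_eq_nsmul ℂ, smul_smul, inv_mul_cancel₀ h2, one_smul]

theorem typeProj_of_hasType_ne {k : ℕ} {a b a' b' : ℕ} (hk' : a' + b' = k) (hne : a' ≠ a)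
    {η : E [⋀^Fin k]→L[ℝ] ℂ} (h : HasType a' b' η) : typeProj a b η = 0 := by
  have h0 : rootU k ≠ 0 := Complex.exp_ne_zero _
  by_cases hk : a + b = k
  swap
  · rw [typeProj, if_neg hk]
  rw [typeProj, if_pos hk]
  set m : ℤ := ((b : ℤ) - a) + (a' - b') with hm
  have hz : rootU k ^ m ≠ 1 := by
    intro h1
    have hd := ((rootU_pow k).zpow_eq_one_iff_dvd m).1 h1
    have h3 := Int.eq_zero_of_abs_lt_dvd hd (by
      rw [abs_lt]; push_cast; constructor <;> omega)
    omega
  have hp : (rootU k ^ m) ^ (2 * k + 1) = 1 := by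
    rw [← zpow_natCast, ← zpow_mul, mul_comm, zpow_mul, zpow_natCast, (rootU_pow k).pow_eq_one,
      one_zpow]
  have : ∀ j ∈ Finset.range (2 * k + 1), ((rootU k ^ j) ^ ((b : ℤ) - (a : ℤ))) •
        η.compContinuousLinearMap (mulCLM E (rootU k ^ j)) = ((rootU k ^ m) ^ j) • η := by
    intro j _
    rw [h.comp_root, smul_smul, ← zpow_add₀ (pow_ne_zero _ h0), ← hm, ← zpow_natCast,
      ← zpow_natCast, ← zpow_mul, ← zpow_mul, mul_comm]
  have hg : ∑ j ∈ Finset.range (2 * k + 1), (rootU k ^ m) ^ j = 0 := by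
    have := geom_sum_mul (rootU k ^ m) (2 * k + 1)
    rw [hp, sub_self] at this
    exact (mul_eq_zero.1 this).resolve_right (sub_ne_zero.2 hz)
  rw [Finset.sum_congr rfl this, ← Finset.sum_smul, hg, zero_smul, smul_zero]

end Pointwise

/-! ### Forms on a complex manifold -/

section Manifold

variable (E : Type*) [NormedAddCommGroup E] [NormedSpace ℂ E]
variable (X : Type*) [TopologicalSpace X] [ChartedSpace E X]

variable {E X} in
/-- The change of coordinates from the chart `e` to the chart `e'`. -/
def trans (e e' : atlas E X) : E → E := fun z => e'.1 (e.1.symm z)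

variable {E X} in
/-- The domain of the change of coordinates, an open subset of the target of `e`. -/
def transDom (e e' : atlas E X) : Set E := (e.1.symm.trans e'.1).source

theorem minSmoothness_two_le : minSmoothness ℝ 2 ≤ ∞ := by
  rw [minSmoothness_of_isRCLikeNormedField]
  exact WithTop.coe_le_coe.2 le_top

/-- The space `A^k(X)` of smooth complex valued differential `k`-forms on `X`: a form is given by
its coordinate expressions in the charts of the atlas, smooth on the chart domain (and extended by
zero outside it), and related by pullback under the changes of coordinates. -/
def formSubmodule (k : ℕ) : Submodule ℂ (atlas E X → E → E [⋀^Fin k]→L[ℝ] ℂ) where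
  carrier := {η |
    (∀ e : atlas E X, ContDiffOn ℝ ∞ (η e) e.1.target) ∧
    (∀ e : atlas E X, ∀ y ∉ e.1.target, η e y = 0) ∧
    ∀ e e' : atlas E X, ∀ y ∈ transDom e e',
      η e y = (η e' (trans e e' y)).compContinuousLinearMap (fderiv ℝ (trans e e') y)}
  add_mem' := by
    rintro a b ⟨ha, ha0, hac⟩ ⟨hb, hb0, hbc⟩
    refine ⟨fun e => (ha e).add (hb e), fun e y hy => ?_, fun e e' y hy => ?_⟩
    · simp [ha0 e y hy, hb0 e y hy]
    · simp only [Pi.add_apply, hac e e' y hy, hbc e e' y hy]; rfl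
  zero_mem' := by
    refine ⟨fun e => contDiffOn_const, fun e y hy => rfl, fun e e' y hy => rfl⟩
  smul_mem' := by
    rintro c a ⟨ha, ha0, hac⟩
    refine ⟨fun e => (ha e).const_smul c, fun e y hy => ?_, fun e e' y hy => ?_⟩
    · simp only [Pi.smul_apply, ha0 e y hy]; module
    · simp only [Pi.smul_apply, hac e e' y hy]; rfl

/-- The type of smooth complex valued differential `k`-forms on `X`. -/
def Form (k : ℕ) : Type _ := ↥(formSubmodule E X k)

instance (k : ℕ) : AddCommGroup (Form E X k) := inferInstanceAs (AddCommGroup (formSubmodule E X k))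

instance (k : ℕ) : Module ℂ (Form E X k) := inferInstanceAs (Module ℂ (formSubmodule E X k))

section FormBasics

variable {E X} {k : ℕ}

/-- The coordinate expression of a form in the chart `e`. -/
def Form.loc (η : Form E X k) (e : atlas E X) : E → E [⋀^Fin k]→L[ℝ] ℂ := η.1 e

/-- The form with given coordinate expressions. -/
def Form.of (f : atlas E X → E → E [⋀^Fin k]→L[ℝ] ℂ) (hf : f ∈ formSubmodule E X k) :
    Form E X k := ⟨f, hf⟩

theorem Form.loc_of (f : atlas E X → E → E [⋀^Fin k]→L[ℝ] ℂ) (hf : f ∈ formSubmodule E X k)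
    (e : atlas E X) : (Form.of f hf).loc e = f e := rfl

/-- Two forms with the same coordinate expressions are equal. -/
theorem Form.ext {η ξ : Form E X k} (h : ∀ e y, η.loc e y = ξ.loc e y) : η = ξ :=
  Subtype.ext (funext fun e => funext fun y => h e y)

theorem Form.contDiffOn_loc (η : Form E X k) (e : atlas E X) :
    ContDiffOn ℝ ∞ (η.loc e) e.1.target := η.2.1 e

theorem Form.loc_of_notMem (η : Form E X k) (e : atlas E X) {y : E} (hy : y ∉ e.1.target) :
    η.loc e y = 0 := η.2.2.1 e y hy

theorem Form.loc_eq (η : Form E X k) (e e' : atlas E X) {y : E} (hy : y ∈ transDom e e') :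
    η.loc e y =
      (η.loc e' (trans e e' y)).compContinuousLinearMap (fderiv ℝ (trans e e') y) :=
  η.2.2.2 e e' y hy

theorem Form.loc_add (η ξ : Form E X k) (e : atlas E X) :
    (η + ξ).loc e = η.loc e + ξ.loc e := rfl

theorem Form.loc_smul (c : ℂ) (η : Form E X k) (e : atlas E X) :
    (c • η).loc e = c • η.loc e := rfl

theorem Form.loc_zero (e : atlas E X) : (0 : Form E X k).loc e = 0 := rfl

theorem differentiableAt_form (η : Form E X k) (e : atlas E X) {y : E}
    (hy : y ∈ e.1.target) : DifferentiableAt ℝ (η.loc e) y :=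
  ((η.contDiffOn_loc e).contDiffAt (e.1.open_target.mem_nhds hy)).differentiableAt (by simp)

theorem contDiffOn_derAct (η : Form E X k) (e : atlas E X) {A : E → E →L[ℝ] E}
    (hA : ContDiffOn ℝ ∞ A e.1.target) :
    ContDiffOn ℝ ∞ (fun y => derAct (A y) (η.loc e y)) e.1.target := by
  have hL := contDiff_fderivCompId (E := E) (F := ℂ) k
  exact (hL.comp_contDiffOn (η.contDiffOn_loc e)).clm_apply hA

end FormBasics

variable {E X} in
theorem isOpen_transDom (e e' : atlas E X) : IsOpen (transDom e e') :=
  (e.1.symm.trans e'.1).open_source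

variable {E X} in
theorem mem_transDom {e e' : atlas E X} {y : E} :
    y ∈ transDom e e' ↔ y ∈ e.1.target ∧ e.1.symm y ∈ e'.1.source := by
  simp [transDom]

variable {E X} in
theorem trans_mem_target {e e' : atlas E X} {y : E} (hy : y ∈ transDom e e') :
    trans e e' y ∈ e'.1.target :=
  e'.1.map_source (mem_transDom.1 hy).2

variable [IsManifold 𝓘(ℂ, E) ω X]

variable {E X} in
theorem contDiffAt_trans (e e' : atlas E X) {y : E} (hy : y ∈ transDom e e') :
    ContDiffAt ℂ ω (trans e e') y := by
  have h := HasGroupoid.compatible (G := contDiffGroupoid ω 𝓘(ℂ, E)) e.2 e'.2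
  rw [contDiffGroupoid, mem_groupoid_of_pregroupoid] at h
  have h1 : ContDiffOn ℂ ω (trans e e') (transDom e e') := by
    have h2 := h.1
    simp only [contDiffPregroupoid, modelWithCornersSelf_coe, modelWithCornersSelf_coe_symm,
      Set.range_id, Set.inter_univ, Set.preimage_id] at h2
    exact h2
  exact h1.contDiffAt ((isOpen_transDom e e').mem_nhds hy)

variable {E X} in
theorem contDiffAt_trans_real (e e' : atlas E X) {y : E} (hy : y ∈ transDom e e') :
    ContDiffAt ℝ ∞ (trans e e') y :=
  ((contDiffAt_trans e e' hy).restrict_scalars ℝ).of_le le_top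

variable {E X} in
theorem fderiv_trans_smul (e e' : atlas E X) {y : E} (hy : y ∈ transDom e e') (c : ℂ) (v : E) :
    fderiv ℝ (trans e e') y (c • v) = c • fderiv ℝ (trans e e') y v := by
  have h : DifferentiableAt ℂ (trans e e') y :=
    (contDiffAt_trans e e' hy).differentiableAt (by simp)
  rw [h.fderiv_restrictScalars ℝ]
  simp

/-- The space `A^{0,1}(X, T^{1,0})` of Beltrami differentials. Identifying `T^{1,0}` with the real
tangent bundle (compatibly with the complex structures), its elements are the smooth fields of
antilinear endomorphisms of the tangent spaces. They are given by their coordinate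
expressions, related by the changes of coordinates. -/
def Beltrami : Submodule ℂ (atlas E X → E → E →L[ℝ] E) where
  carrier := {φ |
    (∀ e : atlas E X, ContDiffOn ℝ ∞ (φ e) e.1.target) ∧
    (∀ e : atlas E X, ∀ y ∉ e.1.target, φ e y = 0) ∧
    (∀ e : atlas E X, ∀ y v : E, φ e y (Complex.I • v) = -(Complex.I • φ e y v)) ∧
    ∀ e e' : atlas E X, ∀ y ∈ transDom e e', ∀ v : E,
      fderiv ℝ (trans e e') y (φ e y v) = φ e' (trans e e' y) (fderiv ℝ (trans e e') y v)}
  add_mem' := by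
    rintro a b ⟨ha, ha0, hai, hac⟩ ⟨hb, hb0, hbi, hbc⟩
    refine ⟨fun e => (ha e).add (hb e), fun e y hy => ?_, fun e y v => ?_, fun e e' y hy v => ?_⟩
    · simp [ha0 e y hy, hb0 e y hy]
    · simp [hai e y v, hbi e y v, add_comm]
    · simp [hac e e' y hy, hbc e e' y hy]
  zero_mem' := by
    refine ⟨fun e => contDiffOn_const, fun e y hy => rfl, fun e y v => ?_, fun e e' y hy v => ?_⟩
    · simp
    · simp
  smul_mem' := by
    rintro c a ⟨ha, ha0, hai, hac⟩
    refine ⟨fun e => (ha e).const_smul c, fun e y hy => ?_, fun e y v => ?_, fun e e' y hy v => ?_⟩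
    · simp [ha0 e y hy]
    · simp [hai e y v, smul_comm c]
    · simp [fderiv_trans_smul e e' hy, hac e e' y hy]

variable {E X}

theorem extDeriv_mem {k : ℕ} (η : Form E X k) :
    (fun e : atlas E X => e.1.target.indicator (extDeriv (η.loc e))) ∈
      formSubmodule E X (k + 1) := by
  refine ⟨fun e => ?_, fun e y hy => Set.indicator_of_notMem hy _, fun e e' y hy => ?_⟩
  · have h1 : ContDiffOn ℝ ∞ (extDeriv (η.loc e)) e.1.target :=
      (ContinuousAlternatingMap.alternatizeUncurryFinCLM ℝ E ℂ).contDiff.comp_contDiffOn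
        ((η.contDiffOn_loc e).fderiv_of_isOpen e.1.open_target (by simp))
    exact h1.congr fun y hy => Set.indicator_of_mem hy _
  · have hy1 := (mem_transDom.1 hy).1
    have hy2 := trans_mem_target hy
    simp only [Set.indicator_of_mem hy1, Set.indicator_of_mem hy2]
    rw [← extDeriv_pullback (r := ∞) (differentiableAt_form η e' hy2)
      (contDiffAt_trans_real e e' hy) minSmoothness_two_le]
    refine Filter.EventuallyEq.extDeriv_eq ?_
    filter_upwards [(isOpen_transDom e e').mem_nhds hy] with z hz
    exact η.loc_eq e e' hz

theorem extDeriv_const_smul {k : ℕ} (c : ℂ) {f : E → E [⋀^Fin k]→L[ℝ] ℂ} {y : E}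
    (h : DifferentiableAt ℝ f y) : extDeriv (c • f) y = c • extDeriv f y := by
  ext v
  rw [ContinuousAlternatingMap.smul_apply, extDeriv_apply h,
    extDeriv_apply (h.const_smul c), Finset.smul_sum]
  refine Finset.sum_congr rfl fun i _ => ?_
  rw [smul_comm c]
  congr 1
  have h' : DifferentiableAt ℝ (fun x => f x (i.removeNth v)) y :=
    (ContinuousAlternatingMap.apply ℝ E ℂ (i.removeNth v)).differentiableAt.comp y h
  exact congrArg (fun L : E →L[ℝ] ℂ => L (v i)) (fderiv_const_smul h' c)

/-- The exterior derivative `d : A^k(X) → A^{k+1}(X)`, computed in coordinates. -/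
def dForm {k : ℕ} : Form E X k →ₗ[ℂ] Form E X (k + 1) where
  toFun η := Form.of (fun e => e.1.target.indicator (extDeriv (η.loc e))) (extDeriv_mem η)
  map_add' η ξ := by
    refine Form.ext fun e y => ?_
    rw [Form.loc_add]
    simp only [Form.loc_of, Pi.add_apply]
    by_cases hy : y ∈ e.1.target
    · simp only [Set.indicator_of_mem hy]
      exact extDeriv_add (differentiableAt_form η e hy) (differentiableAt_form ξ e hy)
    · simp only [Set.indicator_of_notMem hy, add_zero]
  map_smul' c η := by
    refine Form.ext fun e y => ?_
    rw [RingHom.id_apply, Form.loc_smul]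
    simp only [Form.loc_of, Pi.smul_apply]
    by_cases hy : y ∈ e.1.target
    · simp only [Set.indicator_of_mem hy]
      exact extDeriv_const_smul c (differentiableAt_form η e hy)
    · simp only [Set.indicator_of_notMem hy]
      module

theorem dForm_loc {k : ℕ} (η : Form E X k) (e : atlas E X) :
    (dForm η).loc e = e.1.target.indicator (extDeriv (η.loc e)) := rfl

theorem dForm_dForm {k : ℕ} (η : Form E X k) : dForm (dForm η) = 0 := by
  refine Form.ext fun e y => ?_
  rw [dForm_loc, dForm_loc, Form.loc_zero]
  by_cases hy : y ∈ e.1.target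
  · rw [Set.indicator_of_mem hy]
    have h : e.1.target.indicator (extDeriv (η.loc e)) =ᶠ[𝓝 y] extDeriv (η.loc e) := by
      filter_upwards [e.1.open_target.mem_nhds hy] with z hz
      exact Set.indicator_of_mem hz _
    rw [h.extDeriv_eq]
    exact extDeriv_extDeriv_apply
      ((η.contDiffOn_loc e).contDiffAt (e.1.open_target.mem_nhds hy)) minSmoothness_two_le
  · exact Set.indicator_of_notMem hy _

theorem typeProj_mem {k : ℕ} (a b : ℕ) (η : Form E X k) :
    (fun (e : atlas E X) (y : E) => typeProj a b (η.loc e y)) ∈ formSubmodule E X k := by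
  by_cases hk : a + b = k
  swap
  · have : (fun (e : atlas E X) (y : E) => typeProj a b (η.loc e y)) = 0 := by
      funext e y; simp [typeProj, hk]
    rw [this]; exact Submodule.zero_mem _
  refine ⟨fun e => ?_, fun e y hy => ?_, fun e e' y hy => ?_⟩
  · simp only [typeProj, if_pos hk]
    refine ContDiffOn.const_smul _ (ContDiffOn.sum fun j _ => ContDiffOn.const_smul _ ?_)
    exact (ContinuousAlternatingMap.compContinuousLinearMapCLM (F := ℂ) (ι := Fin k)
      (mulCLM E (rootU k ^ j))).contDiff.comp_contDiffOn (η.contDiffOn_loc e)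
  · beta_reduce
    rw [η.loc_of_notMem e hy]
    ext v; rw [typeProj_apply hk]; simp
  · beta_reduce
    rw [η.loc_eq e e' hy]
    ext v
    simp [typeProj_apply hk, fderiv_trans_smul e e' hy, Function.comp_def]

/-- The component `η^{a,b}` of a form `η`. -/
def component {k : ℕ} (a b : ℕ) : Form E X k →ₗ[ℂ] Form E X k where
  toFun η := Form.of (fun e y => typeProj a b (η.loc e y)) (typeProj_mem a b η)
  map_add' _ _ := Form.ext fun _ _ => typeProj_add a b _ _
  map_smul' _ _ := Form.ext fun _ _ => typeProj_smul a b _ _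

/-- The operator `∂̄ : A^k(X) → A^{k+1}(X)`, the sum over all `(a, b)` of the
maps `A^{a,b}(X) → A^{a,b+1}(X)` taking `η` to the `(a, b+1)`-component of `dη`. -/
def dbar {k : ℕ} : Form E X k →ₗ[ℂ] Form E X (k + 1) :=
  ∑ ab ∈ Finset.HasAntidiagonal.antidiagonal k,
    (component ab.1 (ab.2 + 1)).comp (dForm.comp (component ab.1 ab.2))

theorem contrPt_mem {k : ℕ} (φ : Beltrami E X) (η : Form E X k) :
    (fun (e : atlas E X) (y : E) => contrPt (φ.1 e y) (η.loc e y)) ∈ formSubmodule E X k := by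
  refine ⟨fun e => ?_, fun e y hy => ?_, fun e e' y hy => ?_⟩
  · exact ((contDiffOn_derAct η e (φ.2.1 e)).sub ((contDiffOn_derAct η e
      ((φ.2.1 e).const_smul Complex.I)).const_smul _)).const_smul _
  · beta_reduce
    rw [η.loc_of_notMem e hy]
    ext v; rw [contrPt_apply]; simp
  · have hu : ∀ (v : Fin k → E) (j : Fin k) (w : E),
        (fun i => fderiv ℝ (trans e e') y (Function.update v j w i)) =
        Function.update (fun i => fderiv ℝ (trans e e') y (v i)) j
          (fderiv ℝ (trans e e') y w) := by
      intro v j w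
      funext i
      by_cases h : i = j
      · subst h; simp
      · simp [h]
    beta_reduce
    rw [η.loc_eq e e' hy]
    ext v
    simp only [ContinuousAlternatingMap.compContinuousLinearMap_apply, contrPt_apply,
      Function.comp_def, hu, fderiv_trans_smul e e' hy, φ.2.2.2.2 e e' y hy]

/-- The contraction operator `i_φ : A^k(X) → A^k(X)`. -/
def contr {k : ℕ} (φ : Beltrami E X) : Form E X k →ₗ[ℂ] Form E X k where
  toFun η := Form.of (fun e y => contrPt (φ.1 e y) (η.loc e y)) (contrPt_mem φ η)
  map_add' _ _ := Form.ext fun _ _ => contrPt_add _ _ _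
  map_smul' _ _ := Form.ext fun _ _ => contrPt_smul _ _ _

/-! ### The Frölicher spectral sequence -/

variable (E X)

/-- The space `A^{a,b}(X)`, as a subspace of `A^k(X)`; it is zero unless `a + b = k`. -/
def bideg (a b k : ℕ) : Submodule ℂ (Form E X k) where
  carrier := {η | ∀ (e : atlas E X) (y : E), HasType a b (η.loc e y)}
  add_mem' := by
    intro η ξ hη hξ e y c v
    rw [Form.loc_add]
    simp only [Pi.add_apply, ContinuousAlternatingMap.add_apply,
      hη e y c v, hξ e y c v]
    ring
  zero_mem' := by
    intro e y c v
    rw [Form.loc_zero]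
    simp
  smul_mem' := by
    intro z η hη e y c v
    rw [Form.loc_smul]
    simp only [Pi.smul_apply, ContinuousAlternatingMap.smul_apply,
      hη e y c v, smul_eq_mul]
    ring

/-- The filtration `F^p A^k(X) = ⨁_{a ≥ p} A^{a,k-a}(X)`. -/
def filt (p : ℤ) (k : ℕ) : Submodule ℂ (Form E X k) :=
  ⨆ (a : ℕ) (b : ℕ) (_ : p ≤ a), bideg E X a b k

/-- `Z_r^{p,k-p} = F^p A^k ∩ d⁻¹(F^{p+r} A^{k+1})`. Here and below the second index is the total
degree `k`. -/
def frolicherZ (r p : ℤ) (k : ℕ) : Submodule ℂ (Form E X k) :=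
  filt E X p k ⊓ (filt E X (p + r) (k + 1)).comap dForm

/-- `B_r^{p,k-p} = F^p A^k ∩ d(F^{p-r} A^{k-1})`, where `A^{-1} = 0`. -/
def frolicherB (r p : ℤ) : (k : ℕ) → Submodule ℂ (Form E X k)
  | 0 => ⊥
  | k + 1 => filt E X p (k + 1) ⊓ (filt E X (p - r) k).map dForm

/-- The page `E_r^{p,k-p} = Z_r^{p,k-p} / (Z_{r-1}^{p+1,k-p-1} + B_{r-1}^{p,k-p})` of the
Frölicher spectral sequence, for `r ≥ 1`. -/
abbrev FrolicherE (r p : ℤ) (k : ℕ) : Type _ :=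
  frolicherZ E X r p k ⧸
    (frolicherZ E X (r - 1) (p + 1) k ⊔ frolicherB E X (r - 1) p k).submoduleOf
      (frolicherZ E X r p k)

variable {E X} in
theorem dForm_mem_frolicherZ {r p : ℤ} {k : ℕ} {η : Form E X k} (h : η ∈ frolicherZ E X r p k) :
    dForm η ∈ frolicherZ E X r (p + r) (k + 1) := by
  refine ⟨h.2, ?_⟩
  simp only [Submodule.comap_coe, Set.mem_preimage, dForm_dForm]
  exact Submodule.zero_mem _

/-- The differential `d_r^{p,k-p} : E_r^{p,k-p} → E_r^{p+r,k-p-r+1}`, induced by `d`. -/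
def frolicherD (r p : ℤ) (k : ℕ) : FrolicherE E X r p k →ₗ[ℂ] FrolicherE E X r (p + r) (k + 1) :=
  Submodule.mapQ _ _ (dForm.restrict fun _ h => dForm_mem_frolicherZ h) (by
    rintro ⟨η, hη⟩ h
    change dForm η ∈ frolicherZ E X (r - 1) (p + r + 1) (k + 1) ⊔
      frolicherB E X (r - 1) (p + r) (k + 1)
    obtain ⟨a, ha, b, hb, hab⟩ := Submodule.mem_sup.1 (show η ∈ _ ⊔ _ from h)
    have hdb : dForm b = 0 := by
      cases k with
      | zero => rw [(Submodule.mem_bot ℂ).1 hb, map_zero]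
      | succ k =>
        obtain ⟨c, -, rfl⟩ := hb.2
        exact dForm_dForm c
    have hd : dForm η = dForm a := by rw [← hab, map_add, hdb, add_zero]
    refine Submodule.mem_sup_right ⟨hη.2, a, ?_, hd.symm⟩
    have : p + r - (r - 1) = p + 1 := by ring
    rw [this]
    exact ha.1)

variable {E X}

/-! ### Polynomial families

A family depending polynomially on `t = (t₁, …, t_m)` is given by its coefficients: the function
`α : (Fin m →₀ ℕ) → V` stands for `α(t) = ∑_ν α_ν t^ν`, its homogeneous part of degree `k` is
`∑_{|ν| = k} α_ν t^ν` with `|ν| = ν.degree`, and an identity holds modulo `t^{N+1}`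
if it holds for the coefficients of all `t^ν` with `|ν| ≤ N`. -/

/-- The family `i_{φ(t)} α(t)`. -/
def contrSeries {m k : ℕ} (φ : (Fin m →₀ ℕ) → Beltrami E X) (α : (Fin m →₀ ℕ) → Form E X k) :
    (Fin m →₀ ℕ) → Form E X k :=
  fun ν => ∑ x ∈ Finset.HasAntidiagonal.antidiagonal ν, contr (φ x.1) (α x.2)

/-- The family `e^{i_{φ(t)}} α(t) = ∑_j (1 / j!) (i_{φ(t)})^j α(t)`, for `φ` with `φ(0) = 0`, so that
only the terms with `j ≤ |ν|` contribute to the coefficient of `t^ν`. -/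
def expContr {m k : ℕ} (φ : (Fin m →₀ ℕ) → Beltrami E X) (α : (Fin m →₀ ℕ) → Form E X k) :
    (Fin m →₀ ℕ) → Form E X k :=
  fun ν => ∑ j ∈ Finset.range (ν.degree + 1),
    ((j.factorial : ℂ)⁻¹) • ((contrSeries φ)^[j] α) ν

/-! ### The Maurer-Cartan equation in coordinates -/

/-- The derivative of `φ` along the `(1,0)`-part `uⁱ ∂/∂zⁱ` of `u`. -/
def delDir (φ : E → E →L[ℝ] E) (y u : E) : E →L[ℝ] E :=
  (1 / 2 : ℂ) • (fderiv ℝ φ y u - Complex.I • fderiv ℝ φ y (Complex.I • u))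

/-- The derivative of `φ` along the `(0,1)`-part `ūⁱ ∂/∂z̄ⁱ` of `u`. -/
def delbarDir (φ : E → E →L[ℝ] E) (y u : E) : E →L[ℝ] E :=
  (1 / 2 : ℂ) • (fderiv ℝ φ y u + Complex.I • fderiv ℝ φ y (Complex.I • u))

/-- The `T^{1,0}`-valued `(0,2)`-form `∂̄φ = ∑ⱼ ∂̄φʲ ⊗ ∂/∂zʲ`, at the point `y`. -/
def dbarVec (φ : E → E →L[ℝ] E) (y v w : E) : E :=
  delbarDir φ y v w - delbarDir φ y w v

/-- The bracket `[φ, ψ] = ∑ᵢⱼ (φⁱ ∧ ∂ᵢψʲ + ψⁱ ∧ ∂ᵢφʲ) ⊗ ∂/∂zʲ` of `T^{1,0}`-valued `(0,1)`-forms,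
at the point `y`. -/
def bracketVec (φ ψ : E → E →L[ℝ] E) (y v w : E) : E :=
  delDir ψ y (φ y v) w - delDir ψ y (φ y w) v + (delDir φ y (ψ y v) w - delDir φ y (ψ y w) v)

/-- The equation `∂̄φ(t) = ½ [φ(t), φ(t)]` modulo `t^{N+1}`. -/
def IsIntegrableUpTo {m : ℕ} (N : ℕ) (φ : (Fin m →₀ ℕ) → Beltrami E X) : Prop :=
  ∀ ν : Fin m →₀ ℕ, ν.degree ≤ N → ∀ e : atlas E X, ∀ y ∈ e.1.target, ∀ v w : E,
    dbarVec ((φ ν).1 e) y v w = (1 / 2 : ℂ) •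
      ∑ x ∈ Finset.HasAntidiagonal.antidiagonal ν, bracketVec ((φ x.1).1 e) ((φ x.2).1 e) y v w

end Manifold

end CplxForms

end

/-! The proof solves for `α` order by order in `t`, after moving the exponential past `d`. By the
commutator formulas, `[d, i_φ]` is a first-order operator, while `[[d, i_φ], i_φ]` has order zero:
it is minus contraction with the bracket (`dContrTwo_loc`). This contraction commutes with every
`i_φ` (`dContrTwo_contr`), so the expansion stops: `e^{-i_φ} d e^{i_φ} = d + [d, i_φ] + ½ [[d, i_φ],
i_φ]` (`dForm_expContr`).

The Maurer-Cartan equation says that the `∂̄φ` term of `[d, i_φ]` cancels the bracket term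
(`contrTwo_integrable`). What survives besides `d` is built from `∂` and `i_φ` in commutator form.
It sends type `(a, b)` to `(a, b + 1)`, so the conjugated operator preserves `F^p` up to order `N`
(`conjCoeff_mem_filt`, `conjD_mem_filt`). Hence if `d(e^{i_φ} α)` vanishes below order `n`, its
order-`n` coefficients lie in `F^p` (`dForm_expContr_mem_filt`); they are also exact.

The spectral sequence supplies two facts. Vanishing of the differentials leaving `(p, q)` extends
`α₀` to a `d`-closed form in `F^p` without changing its `(p, q)`-component
(`exists_dForm_sub_eq_zero`); this is order zero. Vanishing of the differentials that start in lower
filtration and reach `F^p` makes `d` strict: an exact form in `F^p A^{k+1}` has a primitive in `F^p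
A^k` (`exists_dForm_eq_of_mem_filt`). Subtracting such a primitive kills the obstruction at order
`n` and leaves lower orders unchanged. -/

noncomputable section

namespace CplxForms

open ContinuousAlternatingMap (alternatizeUncurryFin alternatizeUncurryFinCLM curryLeft
  alternatizeUncurryFin_apply alternatizeUncurryFin_add alternatizeUncurryFin_smul
  alternatizeUncurryFin_curryLeft alternatizeUncurryFin_fderivCompContinuousLinearMap_eq_zero)

/-! ### Complex linear and antilinear parts -/

section Parts

variable {V W : Type*} [NormedAddCommGroup V] [NormedSpace ℂ V]
  [NormedAddCommGroup W] [NormedSpace ℂ W]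

/-- The complex linear part of a real-linear map. -/
def linPart (f : V →L[ℝ] W) : V →L[ℝ] W :=
  (1 / 2 : ℂ) • (f - Complex.I • f ∘L mulCLM V Complex.I)

/-- The antilinear part of a real-linear map. -/
def antiPart (f : V →L[ℝ] W) : V →L[ℝ] W :=
  (1 / 2 : ℂ) • (f + Complex.I • f ∘L mulCLM V Complex.I)

theorem linPart_apply (f : V →L[ℝ] W) (u : V) :
    linPart f u = (1 / 2 : ℂ) • (f u - Complex.I • f (Complex.I • u)) := rfl

theorem antiPart_apply (f : V →L[ℝ] W) (u : V) :
    antiPart f u = (1 / 2 : ℂ) • (f u + Complex.I • f (Complex.I • u)) := rfl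

theorem linPart_add_antiPart (f : V →L[ℝ] W) : linPart f + antiPart f = f := by
  simp only [linPart, antiPart]; module

theorem linPart_I_smul (f : V →L[ℝ] W) (u : V) :
    linPart f (Complex.I • u) = Complex.I • linPart f u := by
  simp only [linPart_apply, smul_smul, Complex.I_mul_I, neg_smul, one_smul, map_neg, smul_sub,
    smul_neg]
  rw [← mul_assoc, mul_comm Complex.I, mul_assoc, Complex.I_mul_I]
  module

theorem antiPart_I_smul (f : V →L[ℝ] W) (u : V) :
    antiPart f (Complex.I • u) = -(Complex.I • antiPart f u) := by
  simp only [antiPart_apply, smul_smul, Complex.I_mul_I, neg_smul, one_smul, map_neg, smul_add,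
    smul_neg]
  rw [← mul_assoc, mul_comm Complex.I, mul_assoc, Complex.I_mul_I]
  module

theorem linPart_eq_zero {f : V →L[ℝ] W} (hf : ∀ u, f (Complex.I • u) = -(Complex.I • f u)) :
    linPart f = 0 := by
  ext u
  rw [linPart_apply, hf, smul_neg, smul_smul, Complex.I_mul_I]
  simp

theorem linPart_add (f g : V →L[ℝ] W) : linPart (f + g) = linPart f + linPart g := by
  ext u
  simp only [linPart_apply, add_apply]
  module

theorem map_smul_of_I {f : V →L[ℝ] W} (hf : ∀ u, f (Complex.I • u) = Complex.I • f u)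
    (c : ℂ) (u : V) : f (c • u) = c • f u := by
  rw [← Complex.re_add_im c, add_smul, mul_smul, add_smul, mul_smul, map_add]
  simp only [Complex.coe_smul, map_smul, hf]

theorem map_smul_of_neg_I {f : V →L[ℝ] W} (hf : ∀ u, f (Complex.I • u) = -(Complex.I • f u))
    (c : ℂ) (u : V) : f (c • u) = (starRingEnd ℂ c) • f u := by
  have hc : starRingEnd ℂ c = (c.re : ℂ) - c.im * Complex.I := by
    apply Complex.ext <;> simp
  rw [hc, sub_smul, mul_smul]
  conv_lhs => rw [← Complex.re_add_im c, add_smul, mul_smul, map_add]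
  simp only [Complex.coe_smul, map_smul, hf, smul_neg, sub_eq_add_neg]

end Parts

/-! ### Contractions and alternatization at a point -/

section PointwiseContraction

variable {E : Type*} [NormedAddCommGroup E] [NormedSpace ℂ E] {k : ℕ}

/-- `derAct` as a continuous linear map in the form. -/
def derOp (k : ℕ) (A : E →L[ℝ] E) : (E [⋀^Fin k]→L[ℝ] ℂ) →L[ℝ] (E [⋀^Fin k]→L[ℝ] ℂ) :=
  (ContinuousAlternatingMap.fderivCompContinuousLinearMapCLM (𝕜 := ℝ) (ι := Fin k) ℂ
    (ContinuousLinearMap.id ℝ E)).flip A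

theorem derOp_apply (A : E →L[ℝ] E) (η : E [⋀^Fin k]→L[ℝ] ℂ) : derOp k A η = derAct A η := rfl

/-- `contrPt` as a continuous linear map in the form. -/
def contrOp (k : ℕ) (A : E →L[ℝ] E) : (E [⋀^Fin k]→L[ℝ] ℂ) →L[ℝ] (E [⋀^Fin k]→L[ℝ] ℂ) :=
  (1 / 2 : ℂ) • (derOp k A - Complex.I • derOp k (Complex.I • A))

/-- `contrPt` as a continuous linear map in the endomorphism. -/
def contrL (η : E [⋀^Fin k]→L[ℝ] ℂ) : (E →L[ℝ] E) →L[ℝ] (E [⋀^Fin k]→L[ℝ] ℂ) :=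
  linPart (η.fderivCompContinuousLinearMap (ContinuousLinearMap.id ℝ E))

theorem contrL_smul (η : E [⋀^Fin k]→L[ℝ] ℂ) (c : ℂ) (A : E →L[ℝ] E) :
    contrL η (c • A) = c • contrL η A :=
  map_smul_of_I (linPart_I_smul _) c A

theorem alt_apply (f : E →L[ℝ] E [⋀^Fin k]→L[ℝ] ℂ) (v : Fin (k + 1) → E) :
    alternatizeUncurryFin f v = ∑ i : Fin (k + 1), (-1 : ℂ) ^ (i : ℕ) * f (v i) (i.removeNth v) := by
  rw [alternatizeUncurryFin_apply]
  refine Finset.sum_congr rfl fun i _ => ?_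
  rw [zsmul_eq_mul]; push_cast; rfl

theorem alternatizeUncurryFin_sub (f g : E →L[ℝ] E [⋀^Fin k]→L[ℝ] ℂ) :
    alternatizeUncurryFin (f - g) = alternatizeUncurryFin f - alternatizeUncurryFin g :=
  map_sub (alternatizeUncurryFinCLM ℝ E ℂ) f g

theorem alternatizeUncurryFin_neg (f : E →L[ℝ] E [⋀^Fin k]→L[ℝ] ℂ) :
    alternatizeUncurryFin (-f) = -alternatizeUncurryFin f :=
  map_neg (alternatizeUncurryFinCLM ℝ E ℂ) f

theorem alternatizeUncurryFin_zero :
    alternatizeUncurryFin (0 : E →L[ℝ] E [⋀^Fin k]→L[ℝ] ℂ) = 0 :=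
  map_zero (alternatizeUncurryFinCLM ℝ E ℂ)

/-- `derAct A` is a derivation for alternatization. -/
theorem derAct_alternatizeUncurryFin (A : E →L[ℝ] E) (f : E →L[ℝ] E [⋀^Fin k]→L[ℝ] ℂ) :
    derAct A (alternatizeUncurryFin f) =
      alternatizeUncurryFin (f ∘L A) + alternatizeUncurryFin (derOp k A ∘L f) := by
  ext v
  simp only [derAct_apply, alt_apply, ContinuousAlternatingMap.add_apply,
    ContinuousLinearMap.comp_apply, derOp_apply]
  rw [Finset.sum_comm, ← Finset.sum_add_distrib]
  refine Finset.sum_congr rfl fun i _ => ?_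
  rw [← Finset.mul_sum, ← mul_add]
  congr 1
  -- The slot `j = i` is the one fed to `f`; the remaining slots are those of the form `f (v i)`.
  rw [Fin.sum_univ_succAbove _ i]
  congr 1
  · simp
  · refine Finset.sum_congr rfl fun j _ => ?_
    rw [Function.update_of_ne (Fin.succAbove_ne i j).symm]
    congr 1
    rw [Fin.removeNth_update_succAbove]
    rfl

/-- The vector inserted by the contraction has type `(1,0)`, so the slot fed to `f` sees only the
complex linear part of `f`. In the other slots the contraction acts on the values of `f`. -/
theorem contrPt_alternatizeUncurryFin (A : E →L[ℝ] E) (f : E →L[ℝ] E [⋀^Fin k]→L[ℝ] ℂ) :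
    contrPt A (alternatizeUncurryFin f) =
      alternatizeUncurryFin (linPart f ∘L A) + alternatizeUncurryFin (contrOp k A ∘L f) := by
  have h1 : linPart f ∘L A = (1 / 2 : ℂ) • (f ∘L A - Complex.I • f ∘L (Complex.I • A)) := rfl
  have h2 : contrOp k A ∘L f =
      (1 / 2 : ℂ) • (derOp k A ∘L f - Complex.I • derOp k (Complex.I • A) ∘L f) := rfl
  rw [h1, h2, contrPt, derAct_alternatizeUncurryFin, derAct_alternatizeUncurryFin]
  simp only [alternatizeUncurryFin_smul, alternatizeUncurryFin_sub]
  module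

/-- Opens inductions on the degree: claims about `(k+1)`-forms reduce to alternatizations of maps
into `k`-forms. -/
theorem eq_smul_alternatizeUncurryFin_curryLeft (η : E [⋀^Fin (k + 1)]→L[ℝ] ℂ) :
    η = ((k + 1 : ℕ) : ℂ)⁻¹ • alternatizeUncurryFin (curryLeft η) := by
  rw [alternatizeUncurryFin_curryLeft, ← Nat.cast_smul_eq_nsmul ℂ, smul_smul,
    inv_mul_cancel₀ (Nat.cast_ne_zero.2 (Nat.succ_ne_zero k)), one_smul]

theorem derAct_zero_form (A : E →L[ℝ] E) (η : E [⋀^Fin 0]→L[ℝ] ℂ) : derAct A η = 0 := by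
  ext v; simp [derAct_apply]

/-- Both sides are derivations, so induction on the degree works: in the slot fed to `f` the
commutator is that of the endomorphisms, on the values of `f` it is the induction hypothesis, and
the mixed terms cancel. The order is reversed because endomorphisms act by precomposition. -/
theorem derAct_comm (A B : E →L[ℝ] E) (η : E [⋀^Fin k]→L[ℝ] ℂ) :
    derAct A (derAct B η) - derAct B (derAct A η) = derAct (B ∘L A - A ∘L B) η := by
  induction k with
  | zero => simp only [derAct_zero_form, sub_zero]
  | succ k ih =>
    have key : ∀ f : E →L[ℝ] E [⋀^Fin k]→L[ℝ] ℂ,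
        derAct A (derAct B (alternatizeUncurryFin f)) -
          derAct B (derAct A (alternatizeUncurryFin f)) =
        derAct (B ∘L A - A ∘L B) (alternatizeUncurryFin f) := by
      intro f
      simp only [derAct_alternatizeUncurryFin, derAct_add]
      have h : derOp k (B ∘L A - A ∘L B) ∘L f =
          derOp k A ∘L derOp k B ∘L f - derOp k B ∘L derOp k A ∘L f := by
        ext1 u
        exact (ih (f u)).symm
      rw [h, ContinuousLinearMap.comp_sub, alternatizeUncurryFin_sub, alternatizeUncurryFin_sub]
      simp only [ContinuousLinearMap.comp_assoc]
      abel
    rw [eq_smul_alternatizeUncurryFin_curryLeft η]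
    simp only [derAct_smul]
    rw [← key]
    module

/-- In local terms `i_B` replaces `dz` by `dz̄` and `i_A` kills `dz̄`, so two contractions never act
in the same slot. Below, this appears as cancellation among the four commutators of `A`, `I A` with
`B`, `I B`. -/
theorem contrPt_comm {A B : E →L[ℝ] E} (hA : ∀ v, A (Complex.I • v) = -(Complex.I • A v))
    (hB : ∀ v, B (Complex.I • v) = -(Complex.I • B v)) (η : E [⋀^Fin k]→L[ℝ] ℂ) :
    contrPt A (contrPt B η) = contrPt B (contrPt A η) := by
  have e1 : (Complex.I • B) ∘L A = Complex.I • (B ∘L A) := rfl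
  have e2 : (Complex.I • A) ∘L B = Complex.I • (A ∘L B) := rfl
  have e3 : B ∘L (Complex.I • A) = -(Complex.I • (B ∘L A)) := by ext v; exact hB _
  have e4 : A ∘L (Complex.I • B) = -(Complex.I • (A ∘L B)) := by ext v; exact hA _
  have e5 : (Complex.I • B) ∘L (Complex.I • A) = B ∘L A := by
    ext v
    change Complex.I • B (Complex.I • A v) = B (A v)
    rw [hB, smul_neg, smul_smul, Complex.I_mul_I]; simp
  have e6 : (Complex.I • A) ∘L (Complex.I • B) = A ∘L B := by
    ext v
    change Complex.I • A (Complex.I • B v) = A (B v)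
    rw [hA, smul_neg, smul_smul, Complex.I_mul_I]; simp
  have c1 := derAct_comm A B η
  have c2 := derAct_comm (Complex.I • A) B η
  have c3 := derAct_comm A (Complex.I • B) η
  have c4 := derAct_comm (Complex.I • A) (Complex.I • B) η
  rw [e3, e2] at c2
  rw [e1, e4] at c3
  rw [e5, e6] at c4
  -- By antilinearity the two mixed commutators come from opposite endomorphisms, while those of `A,
  -- B` and of `I A, I B` agree. These are the only two relations needed.
  have c5 : derAct (-(Complex.I • B ∘L A) - Complex.I • A ∘L B) η +
      derAct (Complex.I • B ∘L A - -(Complex.I • A ∘L B)) η = 0 := by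
    rw [derAct, derAct, ← map_add]
    have : -(Complex.I • B ∘L A) - Complex.I • A ∘L B +
      (Complex.I • B ∘L A - -(Complex.I • A ∘L B)) = 0 := by abel
    rw [this, map_zero]
  rw [← c2, ← c3] at c5
  rw [← c1] at c4
  rw [← sub_eq_zero]
  have hI : Complex.I * Complex.I = -1 := Complex.I_mul_I
  have expand : ∀ P Q : E →L[ℝ] E, contrPt P (contrPt Q η) = (1 / 4 : ℂ) •
      (derAct P (derAct Q η) - Complex.I • derAct P (derAct (Complex.I • Q) η)
        - Complex.I • derAct (Complex.I • P) (derAct Q η)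
        - derAct (Complex.I • P) (derAct (Complex.I • Q) η)) := by
    intro P Q
    have hs : ∀ (R : E →L[ℝ] E) (x y : E [⋀^Fin k]→L[ℝ] ℂ),
        derAct R (x - y) = derAct R x - derAct R y := fun R x y => map_sub (derOp k R) x y
    simp only [contrPt, derAct_smul, hs, smul_sub, smul_smul]
    have : (1 / 2 : ℂ) * (Complex.I * (1 / 2 * Complex.I)) = - (1 / 4) := by
      linear_combination (1 / 4 : ℂ) * hI
    rw [this]
    module
  rw [expand A B, expand B A]
  have c4' := sub_eq_zero.2 c4
  calc _ = (1 / 4 : ℂ) • (-(derAct (Complex.I • A) (derAct (Complex.I • B) η) -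
      derAct (Complex.I • B) (derAct (Complex.I • A) η) -
      (derAct A (derAct B η) - derAct B (derAct A η))) - Complex.I •
      (derAct (Complex.I • A) (derAct B η) - derAct B (derAct (Complex.I • A) η) +
      (derAct A (derAct (Complex.I • B) η) - derAct (Complex.I • B) (derAct A η)))) := by module
    _ = 0 := by rw [c4', c5]; module

/-! ### The operators `i_T` for vector valued two-forms -/

/-- The operator `i_T` of degree one, for a bilinear map `T`. -/
def contrTwo (T : E →L[ℝ] E →L[ℝ] E) (η : E [⋀^Fin k]→L[ℝ] ℂ) : E [⋀^Fin (k + 1)]→L[ℝ] ℂ :=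
  alternatizeUncurryFin (contrL η ∘L T)

theorem contrTwo_add (T S : E →L[ℝ] E →L[ℝ] E) (η : E [⋀^Fin k]→L[ℝ] ℂ) :
    contrTwo (T + S) η = contrTwo T η + contrTwo S η := by
  rw [contrTwo, ContinuousLinearMap.comp_add, alternatizeUncurryFin_add]; rfl

theorem contrTwo_smul (c : ℂ) (T : E →L[ℝ] E →L[ℝ] E) (η : E [⋀^Fin k]→L[ℝ] ℂ) :
    contrTwo (c • T) η = c • contrTwo T η := by
  have : contrL η ∘L (c • T) = c • (contrL η ∘L T) := by
    ext1 u; exact contrL_smul η c (T u)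
  rw [contrTwo, this, alternatizeUncurryFin_smul]; rfl

theorem contrTwo_zero (η : E [⋀^Fin k]→L[ℝ] ℂ) :
    contrTwo (0 : E →L[ℝ] E →L[ℝ] E) η = 0 := by
  rw [contrTwo, ContinuousLinearMap.comp_zero, alternatizeUncurryFin_zero]

theorem contrTwo_neg (T : E →L[ℝ] E →L[ℝ] E) (η : E [⋀^Fin k]→L[ℝ] ℂ) :
    contrTwo (-T) η = -contrTwo T η := by
  rw [contrTwo, ContinuousLinearMap.comp_neg, alternatizeUncurryFin_neg]; rfl

theorem contrTwo_sum {ι : Type*} (s : Finset ι) (T : ι → E →L[ℝ] E →L[ℝ] E)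
    (η : E [⋀^Fin k]→L[ℝ] ℂ) : contrTwo (∑ i ∈ s, T i) η = ∑ i ∈ s, contrTwo (T i) η := by
  classical
  induction s using Finset.induction_on with
  | empty => simp [contrTwo_zero]
  | insert a s ha ih => rw [Finset.sum_insert ha, Finset.sum_insert ha, contrTwo_add, ih]

/-- Alternation cancels the terms in which the two arguments of `T` are interchanged. Thus only the
antisymmetrization of `T`, the actual vector-valued two-form, matters. -/
theorem contrTwo_of_symmetric {T : E →L[ℝ] E →L[ℝ] E} (hT : ∀ v w, T v w = T w v)
    (η : E [⋀^Fin k]→L[ℝ] ℂ) : contrTwo T η = 0 := by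
  have hT' : ∀ v w, (Complex.I • T) v w = (Complex.I • T) w v :=
    fun v w => congrArg (Complex.I • ·) (hT v w)
  have h1 := alternatizeUncurryFin_fderivCompContinuousLinearMap_eq_zero η
    (ContinuousLinearMap.id ℝ E) hT
  have h2 := alternatizeUncurryFin_fderivCompContinuousLinearMap_eq_zero η
    (ContinuousLinearMap.id ℝ E) hT'
  have : contrL η ∘L T = (1 / 2 : ℂ) •
      (η.fderivCompContinuousLinearMap (ContinuousLinearMap.id ℝ E) ∘L T - Complex.I •
        η.fderivCompContinuousLinearMap (ContinuousLinearMap.id ℝ E) ∘L (Complex.I • T)) := rfl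
  rw [contrTwo, this, alternatizeUncurryFin_smul, alternatizeUncurryFin_sub,
    alternatizeUncurryFin_smul, h1, h2]
  simp

theorem linPart_contrL_comp (η : E [⋀^Fin k]→L[ℝ] ℂ) (T : E →L[ℝ] E →L[ℝ] E) :
    linPart (contrL η ∘L T) = contrL η ∘L linPart T := by
  ext1 u
  rw [linPart_apply, ContinuousLinearMap.comp_apply, ContinuousLinearMap.comp_apply,
    ContinuousLinearMap.comp_apply, linPart_apply, contrL_smul, map_sub, contrL_smul]

/-- Leibniz rule: `B` enters the first argument of `T` or a remaining slot of `η`. It does not enter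
the second argument, since `T u` is antilinear and contractions by antilinear maps commute. -/
theorem contrPt_contrTwo {B : E →L[ℝ] E} {T : E →L[ℝ] E →L[ℝ] E}
    (hB : ∀ v, B (Complex.I • v) = -(Complex.I • B v))
    (hT : ∀ u v, T u (Complex.I • v) = -(Complex.I • T u v)) (η : E [⋀^Fin k]→L[ℝ] ℂ) :
    contrPt B (contrTwo T η) = contrTwo (linPart T ∘L B) η + contrTwo T (contrPt B η) := by
  rw [contrTwo, contrPt_alternatizeUncurryFin, linPart_contrL_comp]
  have : contrOp k B ∘L contrL η ∘L T = contrL (contrPt B η) ∘L T := by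
    ext1 u
    exact contrPt_comm hB (hT u) η
  rw [this]
  rfl

theorem contrPt_alternatizeUncurryFin_antilinear (B : E →L[ℝ] E)
    {f : E →L[ℝ] E [⋀^Fin k]→L[ℝ] ℂ} (hf : ∀ u, f (Complex.I • u) = -(Complex.I • f u)) :
    contrPt B (alternatizeUncurryFin f) = alternatizeUncurryFin (contrOp k B ∘L f) := by
  rw [contrPt_alternatizeUncurryFin, linPart_eq_zero hf, ContinuousLinearMap.zero_comp,
    alternatizeUncurryFin_zero, zero_add]

end PointwiseContraction

/-! ### Types of forms at a point -/

section PointwiseTypes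

variable {E : Type*} [NormedAddCommGroup E] [NormedSpace ℂ E] {k a b : ℕ}

variable (E) in
/-- The forms of type `(a, b)` at a point. -/
def typePt (a b k : ℕ) : Submodule ℂ (E [⋀^Fin k]→L[ℝ] ℂ) where
  carrier := {η | HasType a b η}
  add_mem' := by
    intro η ξ hη hξ c v
    rw [ContinuousAlternatingMap.add_apply, ContinuousAlternatingMap.add_apply, hη c v, hξ c v]
    ring
  zero_mem' := by intro c v; simp
  smul_mem' := by
    intro z η hη c v
    rw [ContinuousAlternatingMap.smul_apply, ContinuousAlternatingMap.smul_apply, hη c v,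
      smul_eq_mul, smul_eq_mul]
    ring

/-- Scaling all arguments by the real number `2` multiplies `η` by `2 ^ k` by multilinearity and by
`2 ^ (a + b)` by type. -/
theorem HasType.eq_zero {η : E [⋀^Fin k]→L[ℝ] ℂ} (h : HasType a b η) (hk : a + b ≠ k) :
    η = 0 := by
  ext v
  have h1 := h 2 v
  have h2 : η (fun j => (2 : ℂ) • v j) = 2 ^ k * η v := by
    have := η.map_smul_univ (fun _ => (2 : ℝ)) v
    simp only [Finset.prod_const, Finset.card_univ, Fintype.card_fin] at this
    have h3 : (fun j => (2 : ℂ) • v j) = fun j => (2 : ℝ) • v j := by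
      funext j
      exact_mod_cast Complex.coe_smul (2 : ℝ) (v j)
    rw [h3, this, Complex.real_smul]
    push_cast
    rfl
  have h3 : (starRingEnd ℂ) 2 = 2 := Complex.conj_ofNat 2
  rw [h2, h3, ← pow_add] at h1
  by_contra hv
  have h4 : (2 : ℂ) ^ k = 2 ^ (a + b) := mul_right_cancel₀ hv h1
  have h5 : 2 ^ k = 2 ^ (a + b) := by exact_mod_cast h4
  exact hk (Nat.pow_right_injective le_rfl h5).symm

theorem HasType.alternatizeUncurryFin_of_linear {f : E →L[ℝ] E [⋀^Fin k]→L[ℝ] ℂ}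
    (hf : ∀ u, f (Complex.I • u) = Complex.I • f u) (ht : ∀ u, HasType a b (f u)) :
    HasType (a + 1) b (alternatizeUncurryFin f) := by
  intro c v
  rw [alt_apply, alt_apply, Finset.mul_sum]
  refine Finset.sum_congr rfl fun i _ => ?_
  have : i.removeNth (fun j => c • v j) = fun j => c • i.removeNth v j := rfl
  rw [this, map_smul_of_I hf, ContinuousAlternatingMap.smul_apply, ht, smul_eq_mul]
  ring

theorem HasType.alternatizeUncurryFin_of_antilinear {f : E →L[ℝ] E [⋀^Fin k]→L[ℝ] ℂ}
    (hf : ∀ u, f (Complex.I • u) = -(Complex.I • f u)) (ht : ∀ u, HasType a b (f u)) :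
    HasType a (b + 1) (alternatizeUncurryFin f) := by
  intro c v
  rw [alt_apply, alt_apply, Finset.mul_sum]
  refine Finset.sum_congr rfl fun i _ => ?_
  have : i.removeNth (fun j => c • v j) = fun j => c • i.removeNth v j := rfl
  rw [this, map_smul_of_neg_I hf, ContinuousAlternatingMap.smul_apply, ht, smul_eq_mul]
  ring

/-- The contracted slot of `η` is complex linear after taking the `(1,0)`-part; composing with the
antilinear `A` turns one factor `c` into its conjugate. -/
theorem HasType.contrPt {η : E [⋀^Fin k]→L[ℝ] ℂ} (h : HasType (a + 1) b η) {A : E →L[ℝ] E}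
    (hA : ∀ v, A (Complex.I • v) = -(Complex.I • A v)) : HasType a (b + 1) (contrPt A η) := by
  intro c v
  rcases k with _ | k
  · simp [contrPt_apply]
  by_cases hc : c = 0
  -- At `c = 0` both sides vanish, the right one because the exponent `b + 1` is positive.
  · subst hc
    have : (fun j => (0 : ℂ) • v j) = 0 := by funext j; simp
    rw [this, ContinuousAlternatingMap.map_zero]
    simp
  -- The extra factor `c` scales the contracted slot too, so all slots are scaled by `c` and the
  -- type of `η` can be applied.
  apply mul_left_cancel₀ hc
  rw [contrPt_apply, contrPt_apply, Finset.mul_sum, Finset.mul_sum, Finset.mul_sum]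
  refine Finset.sum_congr rfl fun j _ => ?_
  set L : E →L[ℝ] ℂ := linPart (η.toContinuousMultilinearMap.toContinuousLinearMap
    (fun j => c • v j) j) with hL
  have hLa : ∀ w, L w = (1 / 2 : ℂ) * (η (Function.update (fun j => c • v j) j w) -
      Complex.I * η (Function.update (fun j => c • v j) j (Complex.I • w))) := fun w => rfl
  have hu : ∀ w, Function.update (fun j => c • v j) j (c • w) =
      fun i => c • Function.update v j w i := by
    intro w
    funext i
    by_cases hi : i = j
    · subst hi; simp
    · simp [hi]
  have hLs : ∀ z w, L (z • w) = z * L w := fun z w => map_smul_of_I (linPart_I_smul _) z w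
  rw [← hLa, map_smul_of_neg_I hA, hLs]
  have h1 : c * L (A (v j)) = L (c • A (v j)) := (hLs _ _).symm
  rw [mul_left_comm, h1, hLa, smul_comm Complex.I, hu, hu, h, h]
  ring

/-- `typeProj` as a linear map. -/
def typeProjL (a b k : ℕ) : (E [⋀^Fin k]→L[ℝ] ℂ) →ₗ[ℂ] (E [⋀^Fin k]→L[ℝ] ℂ) where
  toFun := typeProj a b
  map_add' := typeProj_add a b
  map_smul' := typeProj_smul a b

variable (E) in
/-- The filtration by the first index of the type, at a point. -/
def filtPt (p : ℤ) (k : ℕ) : Submodule ℂ (E [⋀^Fin k]→L[ℝ] ℂ) :=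
  Submodule.span ℂ {η | ∃ a b : ℕ, p ≤ a ∧ HasType a b η}

theorem HasType.mem_filtPt {p : ℤ} {η : E [⋀^Fin k]→L[ℝ] ℂ} (h : HasType a b η) (hp : p ≤ a) :
    η ∈ filtPt E p k := Submodule.subset_span ⟨a, b, hp, h⟩

theorem filtPt_anti {p p' : ℤ} (h : p ≤ p') : filtPt E p' k ≤ filtPt E p k :=
  Submodule.span_mono fun _ ⟨a, b, hp, hη⟩ => ⟨a, b, h.trans hp, hη⟩

theorem filtPt_induction {p : ℤ} {S : Submodule ℂ (E [⋀^Fin k]→L[ℝ] ℂ)}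
    (h : ∀ a b η, a + b = k → p ≤ (a : ℕ) → HasType a b η → η ∈ S) : filtPt E p k ≤ S := by
  refine Submodule.span_le.2 ?_
  rintro η ⟨a, b, hp, hη⟩
  by_cases hk : a + b = k
  · exact h a b η hk hp hη
  · rw [hη.eq_zero hk]; exact S.zero_mem

theorem hasType_typeProj {p : ℤ} {η : E [⋀^Fin k]→L[ℝ] ℂ} (h : η ∈ filtPt E p k) (a b : ℕ) :
    HasType a b (typeProj a b η) := by
  refine filtPt_induction (S := (typePt E a b k).comap (typeProjL a b k)) ?_ h
  intro a' b' ξ hk _ hξ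
  change typeProj a b ξ ∈ typePt E a b k
  by_cases ha : a' = a
  · by_cases hb : a + b = k
    · have : b' = b := by omega
      subst ha this
      rw [typeProj_of_hasType hk hξ]
      exact hξ
    · rw [typeProj, if_neg hb]; exact Submodule.zero_mem _
  · rw [typeProj_of_hasType_ne hk ha hξ]; exact Submodule.zero_mem _

theorem typeProj_eq_zero_of_lt {p : ℤ} {η : E [⋀^Fin k]→L[ℝ] ℂ} (h : η ∈ filtPt E p k)
    (hap : (a : ℤ) < p) : typeProj a b η = 0 := by
  have := filtPt_induction (p := p) (S := LinearMap.ker (typeProjL (E := E) a b k)) ?_ h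
  · exact this
  intro a' b' ξ hk hp hξ
  exact typeProj_of_hasType_ne hk (by omega) hξ

theorem sum_typeProj {p : ℤ} {η : E [⋀^Fin k]→L[ℝ] ℂ} (h : η ∈ filtPt E p k) :
    ∑ x ∈ Finset.HasAntidiagonal.antidiagonal k, typeProj x.1 x.2 η = η := by
  have := filtPt_induction (p := p) (S := LinearMap.eqLocus (LinearMap.id (R := ℂ))
    (∑ x ∈ Finset.HasAntidiagonal.antidiagonal k, typeProjL (E := E) x.1 x.2 k)) ?_ h
  · rw [LinearMap.mem_eqLocus, LinearMap.id_apply, LinearMap.sum_apply] at this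
    exact this.symm
  intro a b ξ hk _ hξ
  rw [LinearMap.mem_eqLocus, LinearMap.id_apply, LinearMap.sum_apply,
    Finset.sum_eq_single (a, b)]
  · exact (typeProj_of_hasType hk hξ).symm
  · rintro ⟨a', b'⟩ hx hne
    rw [Finset.HasAntidiagonal.mem_antidiagonal] at hx
    refine typeProj_of_hasType_ne hk ?_ hξ
    rintro rfl
    apply hne
    simp only [Prod.mk.injEq, true_and]
    simp only at hx
    omega
  · intro hx
    exact absurd (Finset.HasAntidiagonal.mem_antidiagonal.2 hk) hx

/-- Every form is a sum of forms of pure type. Inductively, write a form as the alternatization of a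
map `f` into forms of lower degree and split the values of `f` by type; the linear part of each
piece then raises `a` and the antilinear part raises `b`. -/
theorem filtPt_eq_top [FiniteDimensional ℂ E] {p : ℤ} (hp : p ≤ 0) : filtPt E p k = ⊤ := by
  rw [eq_top_iff]
  refine le_trans ?_ (filtPt_anti hp)
  induction k with
  | zero =>
    intro η _
    refine HasType.mem_filtPt (a := 0) (b := 0) (fun c v => ?_) (by simp)
    rw [pow_zero, pow_zero, one_mul, one_mul]
    congr 1
    exact Subsingleton.elim _ _
  | succ k ih =>
    have : FiniteDimensional ℝ E := FiniteDimensional.complexToReal E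
    intro η _
    rw [eq_smul_alternatizeUncurryFin_curryLeft η]
    refine Submodule.smul_mem _ _ ?_
    let f : E →L[ℝ] E [⋀^Fin k]→L[ℝ] ℂ := curryLeft η
    -- Finite dimension makes the type components of `f`, given as linear maps, continuous.
    let g : ℕ × ℕ → E →L[ℝ] E [⋀^Fin k]→L[ℝ] ℂ := fun x =>
      LinearMap.toContinuousLinearMap (((typeProjL x.1 x.2 k).restrictScalars ℝ) ∘ₗ f.toLinearMap)
    have hg : f = ∑ x ∈ Finset.HasAntidiagonal.antidiagonal k, g x := by
      ext1 u
      rw [sum_apply]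
      exact (sum_typeProj (ih (Submodule.mem_top (x := f u)))).symm
    have hgt : ∀ x u, HasType x.1 x.2 (g x u) := fun x u =>
      hasType_typeProj (ih (Submodule.mem_top (x := f u))) x.1 x.2
    change alternatizeUncurryFinCLM ℝ E ℂ f ∈ _
    rw [hg, map_sum]
    refine Submodule.sum_mem _ fun x _ => ?_
    rw [← linPart_add_antiPart (g x), map_add]
    refine Submodule.add_mem _ ?_ ?_
    · refine HasType.mem_filtPt (HasType.alternatizeUncurryFin_of_linear (a := x.1) (b := x.2)
        (linPart_I_smul _) fun u => ?_) (by positivity)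
      exact (typePt E x.1 x.2 k).smul_mem _ ((typePt E x.1 x.2 k).sub_mem (hgt x u)
        ((typePt E x.1 x.2 k).smul_mem _ (hgt x _)))
    · refine HasType.mem_filtPt (HasType.alternatizeUncurryFin_of_antilinear (a := x.1) (b := x.2)
        (antiPart_I_smul _) fun u => ?_) (by positivity)
      exact (typePt E x.1 x.2 k).smul_mem _ ((typePt E x.1 x.2 k).add_mem (hgt x u)
        ((typePt E x.1 x.2 k).smul_mem _ (hgt x _)))

end PointwiseTypes

/-! ### The filtration on forms -/

section Filtration

variable {E : Type*} [NormedAddCommGroup E] [NormedSpace ℂ E]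
variable {X : Type*} [TopologicalSpace X] [ChartedSpace E X]
variable {k : ℕ}

theorem bideg_le_filt {p : ℤ} {a b : ℕ} (h : p ≤ a) : bideg E X a b k ≤ filt E X p k :=
  le_iSup_of_le a (le_iSup_of_le b (le_iSup_of_le h le_rfl))

/-- The coordinate expression of a form at a point, as a linear map. -/
def locL (e : atlas E X) (y : E) : Form E X k →ₗ[ℂ] E [⋀^Fin k]→L[ℝ] ℂ where
  toFun η := η.loc e y
  map_add' _ _ := rfl
  map_smul' _ _ := rfl

variable [IsManifold 𝓘(ℂ, E) ω X]

/-- The type projections of a smooth form are again smooth global forms, so a pointwise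
decomposition is a global one. Filtration statements can therefore be checked at a point in a chart.
-/
theorem mem_filt_iff {p : ℤ} {η : Form E X k} :
    η ∈ filt E X p k ↔ ∀ e y, η.loc e y ∈ filtPt E p k := by
  constructor
  · intro h e y
    have : filt E X p k ≤ (filtPt E p k).comap (locL e y) :=
      iSup_le fun a => iSup_le fun b => iSup_le fun hp ξ hξ => (hξ e y).mem_filtPt hp
    exact this h
  · intro h
    have hs : η = ∑ x ∈ Finset.HasAntidiagonal.antidiagonal k, component x.1 x.2 η := by
      refine Form.ext fun e y => ?_
      change _ = locL e y (∑ x ∈ _, _)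
      rw [map_sum]
      exact (sum_typeProj (h e y)).symm
    rw [hs]
    refine Submodule.sum_mem _ fun x _ => ?_
    by_cases hx : (x.1 : ℤ) < p
    · have : component x.1 x.2 η = 0 := Form.ext fun e y => typeProj_eq_zero_of_lt (h e y) hx
      rw [this]; exact Submodule.zero_mem _
    · exact bideg_le_filt (not_lt.1 hx) fun e y => hasType_typeProj (h e y) _ _

theorem filt_anti {p p' : ℤ} (h : p ≤ p') : filt E X p' k ≤ filt E X p k := fun _ hη =>
  mem_filt_iff.2 fun e y => filtPt_anti h (mem_filt_iff.1 hη e y)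

theorem filt_eq_top [FiniteDimensional ℂ E] {p : ℤ} (hp : p ≤ 0) : filt E X p k = ⊤ :=
  eq_top_iff.2 fun η _ => mem_filt_iff.2 fun e y => by
    rw [filtPt_eq_top hp]; exact Submodule.mem_top

theorem eq_zero_of_mem_filt {p : ℤ} (hp : (k : ℤ) < p) {η : Form E X k}
    (h : η ∈ filt E X p k) : η = 0 := by
  refine Form.ext fun e y => ?_
  have : filtPt E p k ≤ ⊥ := filtPt_induction fun a b ξ hk ha _ => by omega
  exact this (mem_filt_iff.1 h e y)

theorem component_eq_zero_of_mem_filt {p : ℤ} {a b : ℕ} (hp : (a : ℤ) < p) {η : Form E X k}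
    (h : η ∈ filt E X p k) : component a b η = 0 :=
  Form.ext fun e y => typeProj_eq_zero_of_lt (mem_filt_iff.1 h e y) hp

theorem component_of_mem_bideg {a b : ℕ} (hk : a + b = k) {η : Form E X k}
    (h : η ∈ bideg E X a b k) : component a b η = η :=
  Form.ext fun e y => typeProj_of_hasType hk (h e y)

theorem component_of_mem_bideg_ne {a b a' b' : ℕ} (hk : a' + b' = k) (hne : a' ≠ a)
    {η : Form E X k} (h : η ∈ bideg E X a' b' k) : component a b η = 0 :=
  Form.ext fun e y => typeProj_of_hasType_ne hk hne (h e y)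

end Filtration

/-! ### Commutators of `d` with contractions -/

/-- Being of a given type and being antilinear are linear conditions, so they pass to derivatives.
-/
theorem clm_fderiv_eq_zero {V W U : Type*} [NormedAddCommGroup V] [NormedSpace ℝ V]
    [NormedAddCommGroup W] [NormedSpace ℝ W] [NormedAddCommGroup U] [NormedSpace ℝ U]
    (L : W →L[ℝ] U) {f : V → W} {y : V} (hf : DifferentiableAt ℝ f y) (h : ∀ z, L (f z) = 0)
    (u : V) : L (fderiv ℝ f y u) = 0 := by
  have h1 : HasFDerivAt (fun z => L (f z)) (L ∘L fderiv ℝ f y) y :=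
    L.hasFDerivAt.comp y hf.hasFDerivAt
  simp only [h] at h1
  exact congrArg (fun M : V →L[ℝ] U => M u) (h1.unique (hasFDerivAt_const 0 y))

theorem filt_le_of_bideg {E : Type*} [NormedAddCommGroup E] [NormedSpace ℂ E]
    {X : Type*} [TopologicalSpace X] [ChartedSpace E X] {k : ℕ} {p : ℤ}
    {S : Submodule ℂ (Form E X k)} (h : ∀ a b : ℕ, p ≤ a → bideg E X a b k ≤ S) :
    filt E X p k ≤ S :=
  iSup_le fun a => iSup_le fun b => iSup_le fun hp => h a b hp

theorem hasFDerivAt_fderivCompId {V E F : Type*} [NormedAddCommGroup V] [NormedSpace ℝ V]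
    [NormedAddCommGroup E] [NormedSpace ℝ E] [NormedAddCommGroup F] [NormedSpace ℝ F] {k : ℕ}
    {η : V → E [⋀^Fin k]→L[ℝ] F} {η' : V →L[ℝ] E [⋀^Fin k]→L[ℝ] F} {B : V → E →L[ℝ] E}
    {B' : V →L[ℝ] E →L[ℝ] E} {y : V} (hη : HasFDerivAt η η' y) (hB : HasFDerivAt B B' y) :
    HasFDerivAt (fun z => (η z).fderivCompContinuousLinearMap (ContinuousLinearMap.id ℝ E) (B z))
      ((η y).fderivCompContinuousLinearMap (ContinuousLinearMap.id ℝ E) ∘L B' +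
        ((ContinuousAlternatingMap.fderivCompContinuousLinearMapCLM (𝕜 := ℝ) (ι := Fin k) F
          (ContinuousLinearMap.id ℝ E)).flip (B y)) ∘L η') y := by
  have hF : HasFDerivAt (fun z => (η z).fderivCompContinuousLinearMap (ContinuousLinearMap.id ℝ E))
      ((ContinuousAlternatingMap.fderivCompContinuousLinearMapCLM (𝕜 := ℝ) (ι := Fin k) F
        (ContinuousLinearMap.id ℝ E)) ∘L η') y :=
    (ContinuousAlternatingMap.fderivCompContinuousLinearMapCLM (𝕜 := ℝ) (ι := Fin k) F
      (ContinuousLinearMap.id ℝ E)).hasFDerivAt.comp y hη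
  refine (hF.clm_apply hB).congr_fderiv ?_
  ext1 u
  rfl

section Commutators

variable {E : Type*} [NormedAddCommGroup E] [NormedSpace ℂ E]
variable {X : Type*} [TopologicalSpace X] [ChartedSpace E X]
variable {k : ℕ}

theorem hasType_fderiv {a b : ℕ} {η : Form E X k} (h : η ∈ bideg E X a b k) {e : atlas E X}
    {y : E} (hy : y ∈ e.1.target) (u : E) : HasType a b (fderiv ℝ (η.loc e) y u) := by
  intro c v
  let L : (E [⋀^Fin k]→L[ℝ] ℂ) →L[ℝ] ℂ :=
    ContinuousAlternatingMap.apply ℝ E ℂ (fun j => c • v j) -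
      (c ^ a * starRingEnd ℂ c ^ b) • ContinuousAlternatingMap.apply ℝ E ℂ v
  exact sub_eq_zero.1 (clm_fderiv_eq_zero L (differentiableAt_form η e hy)
    (fun z => sub_eq_zero.2 (h e z c v)) u)

theorem hasType_linPart_fderiv {a b : ℕ} {η : Form E X k} (h : η ∈ bideg E X a b k)
    {e : atlas E X} {y : E} (hy : y ∈ e.1.target) (u : E) :
    HasType a b (linPart (fderiv ℝ (η.loc e) y) u) :=
  (typePt E a b k).smul_mem _ ((typePt E a b k).sub_mem (hasType_fderiv h hy u)
    ((typePt E a b k).smul_mem _ (hasType_fderiv h hy _)))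

theorem hasType_antiPart_fderiv {a b : ℕ} {η : Form E X k} (h : η ∈ bideg E X a b k)
    {e : atlas E X} {y : E} (hy : y ∈ e.1.target) (u : E) :
    HasType a b (antiPart (fderiv ℝ (η.loc e) y) u) :=
  (typePt E a b k).smul_mem _ ((typePt E a b k).add_mem (hasType_fderiv h hy u)
    ((typePt E a b k).smul_mem _ (hasType_fderiv h hy _)))

variable [IsManifold 𝓘(ℂ, E) ω X]

theorem dForm_loc_of_mem (η : Form E X k) {e : atlas E X} {y : E} (hy : y ∈ e.1.target) :
    (dForm η).loc e y = alternatizeUncurryFin (fderiv ℝ (η.loc e) y) := by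
  rw [dForm_loc, Set.indicator_of_mem hy]; rfl

theorem contr_loc (A : Beltrami E X) (η : Form E X k) (e : atlas E X) (y : E) :
    (contr A η).loc e y = contrPt (A.1 e y) (η.loc e y) := rfl

/-- The two components of the exterior derivative of a form of type `(a, b)`. -/
theorem exists_dForm_loc_eq_add {a b : ℕ} {η : Form E X k} (h : η ∈ bideg E X a b k)
    (e : atlas E X) (y : E) :
    ∃ ξ ζ : E [⋀^Fin (k + 1)]→L[ℝ] ℂ, HasType (a + 1) b ξ ∧ HasType a (b + 1) ζ ∧
      (dForm η).loc e y = ξ + ζ := by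
  by_cases hy : y ∈ e.1.target
  · refine ⟨alternatizeUncurryFin (linPart (fderiv ℝ (η.loc e) y)),
      alternatizeUncurryFin (antiPart (fderiv ℝ (η.loc e) y)),
      HasType.alternatizeUncurryFin_of_linear (linPart_I_smul _) (hasType_linPart_fderiv h hy),
      HasType.alternatizeUncurryFin_of_antilinear (antiPart_I_smul _)
        (hasType_antiPart_fderiv h hy), ?_⟩
    rw [dForm_loc_of_mem η hy, ← alternatizeUncurryFin_add, linPart_add_antiPart]
  · exact ⟨0, 0, (typePt E _ _ _).zero_mem, (typePt E _ _ _).zero_mem, by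
      rw [Form.loc_of_notMem _ e hy, add_zero]⟩

theorem dForm_mem_filt {p : ℤ} {η : Form E X k} (h : η ∈ filt E X p k) :
    dForm η ∈ filt E X p (k + 1) := by
  have : filt E X p k ≤ (filt E X p (k + 1)).comap dForm := by
    refine filt_le_of_bideg fun a b hp ξ hξ => mem_filt_iff.2 fun e y => ?_
    obtain ⟨ξ₁, ξ₂, h1, h2, h3⟩ := exists_dForm_loc_eq_add hξ e y
    rw [h3]
    exact Submodule.add_mem _ (h1.mem_filtPt (by push_cast; omega)) (h2.mem_filtPt hp)
  exact this h

/-- A `∂̄`-closed form of type `(p, q)` has exterior derivative in `F^{p+1}`. -/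
theorem dForm_mem_filt_of_dbar_eq_zero {p q : ℕ} {η : Form E X (p + q)}
    (h : η ∈ bideg E X p q (p + q)) (hd : dbar η = 0) :
    dForm η ∈ filt E X (p + 1) (p + q + 1) := by
  have h1 : component p (q + 1) (dForm η) = 0 := by
    rw [← hd, dbar, LinearMap.sum_apply, Finset.sum_eq_single (p, q)]
    · simp only [LinearMap.comp_apply, component_of_mem_bideg rfl h]
    · rintro ⟨a, b⟩ hx hne
      rw [Finset.HasAntidiagonal.mem_antidiagonal] at hx
      simp only at hx
      have : component a b η = 0 := by
        refine component_of_mem_bideg_ne rfl ?_ h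
        rintro rfl
        apply hne
        simp only [Prod.mk.injEq, true_and]
        omega
      simp only [LinearMap.comp_apply, this, map_zero]
    · intro hx
      exact absurd (Finset.HasAntidiagonal.mem_antidiagonal.2 (rfl : p + q = p + q)) hx
  refine mem_filt_iff.2 fun e y => ?_
  obtain ⟨ξ, ζ, hξ, hζ, h3⟩ := exists_dForm_loc_eq_add h e y
  have h4 : typeProj p (q + 1) ((dForm η).loc e y) = 0 :=
    congrArg (fun ξ : Form E X (p + q + 1) => ξ.loc e y) h1
  rw [h3, typeProj_add, typeProj_of_hasType_ne (by omega) (by omega) hξ,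
    typeProj_of_hasType (by omega) hζ, zero_add] at h4
  rw [h3, h4, add_zero]
  exact hξ.mem_filtPt (by push_cast; omega)

theorem Beltrami.differentiableAt (A : Beltrami E X) {e : atlas E X} {y : E}
    (hy : y ∈ e.1.target) : DifferentiableAt ℝ (A.1 e) y :=
  ((A.2.1 e).contDiffAt (e.1.open_target.mem_nhds hy)).differentiableAt (by simp)

theorem Beltrami.map_I_smul (A : Beltrami E X) (e : atlas E X) (y v : E) :
    A.1 e y (Complex.I • v) = -(Complex.I • A.1 e y v) := A.2.2.2.1 e y v

theorem Beltrami.fderiv_map_I_smul (A : Beltrami E X) {e : atlas E X} {y : E}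
    (hy : y ∈ e.1.target) (u v : E) :
    fderiv ℝ (A.1 e) y u (Complex.I • v) = -(Complex.I • fderiv ℝ (A.1 e) y u v) := by
  let L : (E →L[ℝ] E) →L[ℝ] E :=
    ContinuousLinearMap.apply ℝ E (Complex.I • v) + Complex.I • ContinuousLinearMap.apply ℝ E v
  exact eq_neg_of_add_eq_zero_left (clm_fderiv_eq_zero L (Beltrami.differentiableAt A hy)
    (fun z => by
      change A.1 e z (Complex.I • v) + Complex.I • A.1 e z v = 0
      rw [Beltrami.map_I_smul A, neg_add_cancel]) u)

theorem Beltrami.linPart_fderiv_map_I_smul (A : Beltrami E X) {e : atlas E X} {y : E}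
    (hy : y ∈ e.1.target) (u v : E) : linPart (fderiv ℝ (A.1 e) y) u (Complex.I • v) =
      -(Complex.I • linPart (fderiv ℝ (A.1 e) y) u v) := by
  simp only [linPart_apply, smul_apply, sub_apply, Beltrami.fderiv_map_I_smul A hy]
  module

theorem fderiv_contr (A : Beltrami E X) (η : Form E X k) {e : atlas E X} {y : E}
    (hy : y ∈ e.1.target) : fderiv ℝ ((contr A η).loc e) y =
      contrL (η.loc e y) ∘L fderiv ℝ (A.1 e) y +
        contrOp k (A.1 e y) ∘L fderiv ℝ (η.loc e) y := by
  let F := ContinuousAlternatingMap.fderivCompContinuousLinearMapCLM (𝕜 := ℝ) (ι := Fin k) ℂ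
    (ContinuousLinearMap.id ℝ E)
  have hη := (differentiableAt_form η e hy).hasFDerivAt
  have hA := (Beltrami.differentiableAt A hy).hasFDerivAt
  have h0 : ∀ {B : E → E →L[ℝ] E} {B' : E →L[ℝ] E →L[ℝ] E}, HasFDerivAt B B' y →
      HasFDerivAt (fun z => derAct (B z) (η.loc e z)) _ y :=
    fun hB => hasFDerivAt_fderivCompId hη hB
  have h := ((h0 hA).sub ((h0 (hA.const_smul Complex.I)).const_smul Complex.I)).const_smul
    (1 / 2 : ℂ)
  refine HasFDerivAt.fderiv (h.congr_fderiv ?_)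
  ext1 u
  change (1 / 2 : ℂ) • (F (η.loc e y) (fderiv ℝ (A.1 e) y u) +
      F (fderiv ℝ (η.loc e) y u) (A.1 e y) -
      Complex.I • (F (η.loc e y) (Complex.I • fderiv ℝ (A.1 e) y u) +
        F (fderiv ℝ (η.loc e) y u) (Complex.I • A.1 e y))) =
    (1 / 2 : ℂ) • (F (η.loc e y) (fderiv ℝ (A.1 e) y u) -
        Complex.I • F (η.loc e y) (Complex.I • fderiv ℝ (A.1 e) y u)) +
      (1 / 2 : ℂ) • (F (fderiv ℝ (η.loc e) y u) (A.1 e y) -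
        Complex.I • F (fderiv ℝ (η.loc e) y u) (Complex.I • A.1 e y))
  module

theorem linPart_contrOp_comp (A : E →L[ℝ] E) (f : E →L[ℝ] E [⋀^Fin k]→L[ℝ] ℂ) :
    linPart (contrOp k A ∘L f) = contrOp k A ∘L linPart f := by
  ext1 u
  have hs : ∀ (c : ℂ) ξ, contrOp k A (c • ξ) = c • contrOp k A ξ := fun c ξ => contrPt_smul A c ξ
  rw [linPart_apply, ContinuousLinearMap.comp_apply, ContinuousLinearMap.comp_apply,
    ContinuousLinearMap.comp_apply, linPart_apply, hs, map_sub, hs]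

/-- The commutator `[d, i_A]`. -/
def dContr (A : Beltrami E X) : Form E X k →ₗ[ℂ] Form E X (k + 1) :=
  dForm ∘ₗ contr A - contr A ∘ₗ dForm

/-- The terms in which `i_A` acts on the values of the derivative of `η` occur in both `d i_A η` and
`i_A d η` and cancel. There remain a term of order zero in `η` and a derivative of `η` in the
`(1,0)`-direction given by `A`. -/
theorem dContr_loc (A : Beltrami E X) (η : Form E X k) {e : atlas E X} {y : E}
    (hy : y ∈ e.1.target) : (dContr A η).loc e y =
      contrTwo (fderiv ℝ (A.1 e) y) (η.loc e y) -
        alternatizeUncurryFin (linPart (fderiv ℝ (η.loc e) y) ∘L A.1 e y) := by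
  change (dForm (contr A η)).loc e y - contrPt (A.1 e y) ((dForm η).loc e y) = _
  rw [dForm_loc_of_mem _ hy, dForm_loc_of_mem _ hy, fderiv_contr A η hy,
    contrPt_alternatizeUncurryFin, alternatizeUncurryFin_add, contrTwo]
  abel

/-- The bilinear map whose alternatization is the bracket of `A` and `B`. -/
def bracketPt (A B : Beltrami E X) (e : atlas E X) (y : E) : E →L[ℝ] E →L[ℝ] E :=
  linPart (fderiv ℝ (B.1 e) y) ∘L A.1 e y + linPart (fderiv ℝ (A.1 e) y) ∘L B.1 e y

theorem antilinear_comp {V : Type*} [NormedAddCommGroup V] [NormedSpace ℂ V] {f : E →L[ℝ] V}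
    {B : E →L[ℝ] E} (hf : ∀ u, f (Complex.I • u) = Complex.I • f u)
    (hB : ∀ v, B (Complex.I • v) = -(Complex.I • B v)) (u : E) :
    (f ∘L B) (Complex.I • u) = -(Complex.I • (f ∘L B) u) := by
  rw [ContinuousLinearMap.comp_apply, hB, map_neg, hf]; rfl

theorem bracketPt_map_I_smul (A B : Beltrami E X) {e : atlas E X} {y : E}
    (hy : y ∈ e.1.target) (u v : E) :
    bracketPt A B e y u (Complex.I • v) = -(Complex.I • bracketPt A B e y u v) := by
  simp only [bracketPt, add_apply, ContinuousLinearMap.comp_apply,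
    Beltrami.linPart_fderiv_map_I_smul _ hy]
  module

theorem linPart_bracketPt (A B : Beltrami E X) (e : atlas E X) (y : E) :
    linPart (bracketPt A B e y) = 0 := by
  rw [bracketPt, linPart_add,
    linPart_eq_zero (antilinear_comp (linPart_I_smul _) (Beltrami.map_I_smul A e y)),
    linPart_eq_zero (antilinear_comp (linPart_I_smul _) (Beltrami.map_I_smul B e y)), add_zero]

/-- The iterated commutator `[[d, i_A], i_B]`. -/
def dContrTwo (A B : Beltrami E X) : Form E X k →ₗ[ℂ] Form E X (k + 1) :=
  dContr A ∘ₗ contr B - contr B ∘ₗ dContr A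

/-- All derivatives of `η` cancel, as does the contraction of `i_B η` with the derivative of `A`.
What is left is `A` differentiated along `B` and `B` differentiated along `A`. -/
theorem dContrTwo_loc (A B : Beltrami E X) (η : Form E X k) {e : atlas E X} {y : E}
    (hy : y ∈ e.1.target) :
    (dContrTwo A B η).loc e y = -contrTwo (bracketPt A B e y) (η.loc e y) := by
  change (dContr A (contr B η)).loc e y - contrPt (B.1 e y) ((dContr A η).loc e y) = _
  have hsub : ∀ ξ ζ : E [⋀^Fin (k + 1)]→L[ℝ] ℂ,
      contrPt (B.1 e y) (ξ - ζ) = contrPt (B.1 e y) ξ - contrPt (B.1 e y) ζ := fun ξ ζ =>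
    map_sub (contrOp (k + 1) (B.1 e y)) ξ ζ
  rw [dContr_loc _ _ hy, dContr_loc _ _ hy, hsub,
    contrPt_contrTwo (Beltrami.map_I_smul B e y) (Beltrami.fderiv_map_I_smul A hy),
    contrPt_alternatizeUncurryFin_antilinear _
      (antilinear_comp (linPart_I_smul _) (Beltrami.map_I_smul A e y)),
    fderiv_contr B η hy, linPart_add, linPart_contrL_comp, linPart_contrOp_comp,
    ContinuousLinearMap.add_comp, alternatizeUncurryFin_add, bracketPt, contrTwo_add,
    ContinuousLinearMap.comp_assoc, ContinuousLinearMap.comp_assoc, contr_loc]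
  change _ - (contrTwo _ _ + _) - _ = _
  abel

/-- The bracket is antilinear in both arguments, so neither can absorb the `(1,0)`-vector inserted
by `i_C`. This vanishing third commutator ends the conjugation series. -/
theorem dContrTwo_contr (A B C : Beltrami E X) (η : Form E X k) :
    dContrTwo A B (contr C η) = contr C (dContrTwo A B η) := by
  refine Form.ext fun e y => ?_
  by_cases hy : y ∈ e.1.target
  · have hneg : ∀ ξ : E [⋀^Fin (k + 1)]→L[ℝ] ℂ,
        contrPt (C.1 e y) (-ξ) = -contrPt (C.1 e y) ξ := fun ξ =>
      map_neg (contrOp (k + 1) (C.1 e y)) ξ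
    rw [dContrTwo_loc _ _ _ hy, contr_loc, contr_loc, dContrTwo_loc _ _ _ hy, hneg,
      contrPt_contrTwo (Beltrami.map_I_smul C e y) (bracketPt_map_I_smul A B hy), linPart_bracketPt,
      ContinuousLinearMap.zero_comp, contrTwo_zero, zero_add]
  · rw [Form.loc_of_notMem _ e hy, Form.loc_of_notMem _ e hy]

end Commutators

/-! ### Conjugation by a truncated exponential -/

section Exponential

variable {V W : Type*} [AddCommGroup V] [Module ℂ V] [AddCommGroup W] [Module ℂ W]

/-- The truncated exponential `∑_{j < M} I^j / j!`. -/
def expTrunc (I : Module.End ℂ V) (M : ℕ) : Module.End ℂ V :=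
  ∑ j ∈ Finset.range M, ((j.factorial : ℂ)⁻¹) • I ^ j

variable {I : Module.End ℂ V} {J : Module.End ℂ W} {D₀ D₁ D₂ : V →ₗ[ℂ] W}

/-- Binomial formula for moving `D₀` past a power when the third commutator is zero. The exponent `n
+ 2` avoids truncated subtraction. -/
theorem apply_pow_add_two (h₀ : ∀ α, D₀ (I α) = J (D₀ α) + D₁ α)
    (h₁ : ∀ α, D₁ (I α) = J (D₁ α) + D₂ α) (h₂ : ∀ α, D₂ (I α) = J (D₂ α)) (n : ℕ) (α : V) :
    D₀ ((I ^ (n + 2)) α) = (J ^ (n + 2)) (D₀ α) + ((n : ℂ) + 2) • (J ^ (n + 1)) (D₁ α) +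
      (((n : ℂ) + 2) * (n + 1) / 2) • (J ^ n) (D₂ α) := by
  induction n generalizing α with
  | zero =>
    simp only [pow_succ, pow_zero, Module.End.mul_apply, Module.End.one_apply, h₀, h₁,
      map_add, Nat.cast_zero]
    module
  | succ n ih =>
    rw [show n + 1 + 2 = (n + 2) + 1 by ring, pow_succ I, Module.End.mul_apply, ih]
    simp only [h₀, h₁, h₂, map_add, Nat.cast_add, Nat.cast_one]
    have e : ∀ (l : ℕ) (β : W), (J ^ l) (J β) = (J ^ (l + 1)) β := fun l β => by
      rw [pow_succ, Module.End.mul_apply]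
    simp only [e]
    module

/-- Dividing the binomial formula by factorials separates it into products of exponential
coefficients. Each commutator uses up one power, so the truncation drops by one each time. -/
theorem apply_expTrunc (h₀ : ∀ α, D₀ (I α) = J (D₀ α) + D₁ α)
    (h₁ : ∀ α, D₁ (I α) = J (D₁ α) + D₂ α) (h₂ : ∀ α, D₂ (I α) = J (D₂ α)) (M : ℕ) (α : V) :
    D₀ (expTrunc I (M + 2) α) = expTrunc J (M + 2) (D₀ α) + expTrunc J (M + 1) (D₁ α) +
      (1 / 2 : ℂ) • expTrunc J M (D₂ α) := by
  induction M with
  | zero =>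
    simp [expTrunc, Finset.sum_range_succ, h₀]
    abel
  | succ M ih =>
    have e : ∀ (n : ℕ) (β : W),
        expTrunc J (n + 1) β = expTrunc J n β + ((n.factorial : ℂ)⁻¹) • (J ^ n) β := by
      intro n β
      rw [expTrunc, Finset.sum_range_succ]; rfl
    rw [show M + 1 + 2 = (M + 2) + 1 by ring, show M + 1 + 1 = M + 2 by ring]
    rw [expTrunc, Finset.sum_range_succ]
    change D₀ (expTrunc I (M + 2) α + ((M + 2).factorial : ℂ)⁻¹ • (I ^ (M + 2)) α) = _
    rw [map_add, map_smul, ih, apply_pow_add_two h₀ h₁ h₂, e (M + 2) (D₀ α),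
      e M (D₂ α), show M + 2 = M + 1 + 1 by ring, e (M + 1) (D₁ α)]
    have f1 : ((M : ℂ) + 1) ≠ 0 := by exact_mod_cast M.succ_ne_zero
    have f2 : ((M : ℂ) + 2) ≠ 0 := by exact_mod_cast (M + 1).succ_ne_zero
    -- All coefficients are rewritten as multiples of `1 / (M + 2)!`, after which the identity is
    -- polynomial in `M`.
    have g1 : (((M + 1).factorial : ℕ) : ℂ)⁻¹ =
        ((M : ℂ) + 2) * (((M + 1 + 1).factorial : ℕ) : ℂ)⁻¹ := by
      rw [Nat.factorial_succ (M + 1)]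
      push_cast
      rw [show (M : ℂ) + 1 + 1 = M + 2 by ring, mul_inv, ← mul_assoc, mul_inv_cancel₀ f2, one_mul]
    have g0 : ((M.factorial : ℕ) : ℂ)⁻¹ =
        ((M : ℂ) + 2) * (M + 1) * (((M + 1 + 1).factorial : ℕ) : ℂ)⁻¹ := by
      rw [mul_right_comm, ← g1, Nat.factorial_succ M]
      push_cast
      rw [mul_inv, mul_right_comm, inv_mul_cancel₀ f1, one_mul]
    rw [g1, g0]
    module

end Exponential

/-! ### Convolution of families -/

section Convolution

variable {m : ℕ} {V W U : Type*} [AddCommGroup V] [Module ℂ V] [AddCommGroup W] [Module ℂ W]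
  [AddCommGroup U] [Module ℂ U]

/-- The action of a family of linear maps on families of vectors by multiplication of series. -/
def conv (θ : (Fin m →₀ ℕ) → V →ₗ[ℂ] W) : ((Fin m →₀ ℕ) → V) →ₗ[ℂ] ((Fin m →₀ ℕ) → W) where
  toFun α ν := ∑ x ∈ Finset.HasAntidiagonal.antidiagonal ν, θ x.1 (α x.2)
  map_add' α β := by
    funext ν
    simp only [Pi.add_apply, map_add, Finset.sum_add_distrib]
  map_smul' c α := by
    funext ν
    simp only [Pi.smul_apply, map_smul, Finset.smul_sum, RingHom.id_apply]

theorem conv_apply (θ : (Fin m →₀ ℕ) → V →ₗ[ℂ] W) (α : (Fin m →₀ ℕ) → V) (ν : Fin m →₀ ℕ) :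
    conv θ α ν = ∑ x ∈ Finset.HasAntidiagonal.antidiagonal ν, θ x.1 (α x.2) := rfl

theorem conv_conv (θ : (Fin m →₀ ℕ) → W →ₗ[ℂ] U) (ξ : (Fin m →₀ ℕ) → V →ₗ[ℂ] W)
    (α : (Fin m →₀ ℕ) → V) : conv θ (conv ξ α) =
      conv (fun ν => ∑ x ∈ Finset.HasAntidiagonal.antidiagonal ν, θ x.1 ∘ₗ ξ x.2) α := by
  funext ν
  simp only [conv_apply, map_sum, LinearMap.sum_apply, LinearMap.comp_apply, Finset.sum_sigma']
  -- Both sides run over triples of multi-indices with sum `ν`, bracketed in the two possible ways.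
  refine Finset.sum_nbij' (fun z => ⟨(z.1.1 + z.2.1, z.2.2), (z.1.1, z.2.1)⟩)
    (fun z => ⟨(z.2.1, z.2.2 + z.1.2), (z.2.2, z.1.2)⟩) ?_ ?_ ?_ ?_ ?_
  · rintro ⟨⟨a, b⟩, ⟨c, d⟩⟩ h
    simp only [Finset.mem_sigma, Finset.HasAntidiagonal.mem_antidiagonal] at h ⊢
    exact ⟨by rw [add_assoc, h.2, h.1], trivial⟩
  · rintro ⟨⟨a, b⟩, ⟨c, d⟩⟩ h
    simp only [Finset.mem_sigma, Finset.HasAntidiagonal.mem_antidiagonal] at h ⊢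
    exact ⟨by rw [← add_assoc, h.2, h.1], trivial⟩
  · rintro ⟨⟨a, b⟩, ⟨c, d⟩⟩ h
    simp only [Finset.mem_sigma, Finset.HasAntidiagonal.mem_antidiagonal] at h
    obtain ⟨-, rfl⟩ := h
    rfl
  · rintro ⟨⟨a, b⟩, ⟨c, d⟩⟩ h
    simp only [Finset.mem_sigma, Finset.HasAntidiagonal.mem_antidiagonal] at h
    obtain ⟨-, rfl⟩ := h
    rfl
  · rintro ⟨⟨a, b⟩, ⟨c, d⟩⟩ _
    rfl

theorem sum_antidiagonal_swap {M : Type*} [AddCommMonoid M] (ν : Fin m →₀ ℕ)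
    (f : (Fin m →₀ ℕ) → (Fin m →₀ ℕ) → M) :
    ∑ x ∈ Finset.HasAntidiagonal.antidiagonal ν, f x.2 x.1 =
      ∑ x ∈ Finset.HasAntidiagonal.antidiagonal ν, f x.1 x.2 :=
  Finset.sum_nbij' Prod.swap Prod.swap
    (by simp [Finset.HasAntidiagonal.mem_antidiagonal, add_comm])
    (by simp [Finset.HasAntidiagonal.mem_antidiagonal, add_comm]) (by simp) (by simp) (by simp)

/-- Without a constant term, `θ` raises the order of vanishing in `t`; this makes the exponential a
finite sum in each degree. -/
theorem conv_eq_zero_of_lt {θ : (Fin m →₀ ℕ) → V →ₗ[ℂ] W} (hθ : θ 0 = 0) {n : ℕ}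
    {α : (Fin m →₀ ℕ) → V} (hα : ∀ ν, ν.degree < n → α ν = 0) (ν : Fin m →₀ ℕ)
    (hν : ν.degree < n + 1) : conv θ α ν = 0 := by
  rw [conv_apply]
  refine Finset.sum_eq_zero ?_
  rintro ⟨a, b⟩ hx
  rw [Finset.HasAntidiagonal.mem_antidiagonal] at hx
  simp only at hx
  by_cases ha : a = 0
  · subst ha; simp [hθ]
  · have h1 : a.degree ≠ 0 := fun h => ha ((Finsupp.degree_eq_zero_iff a).1 h)
    have h2 : a.degree + b.degree = ν.degree := by rw [← hx, map_add]
    rw [hα b (by omega), map_zero]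

variable {θ : (Fin m →₀ ℕ) → V →ₗ[ℂ] V}

theorem conv_pow_eq_zero_of_lt (hθ : θ 0 = 0) {n : ℕ} {α : (Fin m →₀ ℕ) → V}
    (hα : ∀ ν, ν.degree < n → α ν = 0) (j : ℕ) (ν : Fin m →₀ ℕ) (hν : ν.degree < n + j) :
    ((conv θ : Module.End ℂ _) ^ j) α ν = 0 := by
  induction j generalizing ν with
  | zero => exact hα ν hν
  | succ j ih =>
    rw [pow_succ', Module.End.mul_apply]
    exact conv_eq_zero_of_lt hθ ih ν hν

theorem expTrunc_apply (I : Module.End ℂ ((Fin m →₀ ℕ) → V)) (M : ℕ) (α : (Fin m →₀ ℕ) → V)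
    (ν : Fin m →₀ ℕ) :
    expTrunc I M α ν = ∑ j ∈ Finset.range M, ((j.factorial : ℂ)⁻¹) • (I ^ j) α ν := by
  rw [expTrunc, LinearMap.sum_apply, Finset.sum_apply]
  rfl

/-- Allows the different truncations in `apply_expTrunc` and the degree-dependent one in `expContr`
to be identified. -/
theorem expTrunc_conv_eq_of_lt (hθ : θ 0 = 0) (α : (Fin m →₀ ℕ) → V) (ν : Fin m →₀ ℕ) {M : ℕ}
    (hM : ν.degree < M) : expTrunc (conv θ) M α ν = expTrunc (conv θ) (ν.degree + 1) α ν := by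
  rw [expTrunc_apply, expTrunc_apply]
  symm
  refine Finset.sum_subset (Finset.range_subset_range.2 hM) fun j _ hj => ?_
  rw [conv_pow_eq_zero_of_lt hθ (n := 0) (by simp) j ν (by simp at hj; omega), smul_zero]

/-- The lowest order part is not changed by the exponential. -/
theorem expTrunc_conv_of_le (hθ : θ 0 = 0) {n : ℕ} {α : (Fin m →₀ ℕ) → V}
    (hα : ∀ ν, ν.degree < n → α ν = 0) (ν : Fin m →₀ ℕ) (hν : ν.degree ≤ n) (M : ℕ) :
    expTrunc (conv θ) (M + 1) α ν = α ν := by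
  rw [expTrunc_apply, Finset.sum_range_succ', Finset.sum_eq_zero, zero_add]
  · simp
  · intro j _
    rw [conv_pow_eq_zero_of_lt hθ hα (j + 1) ν (by omega), smul_zero]

end Convolution

/-! ### The conjugate of `d` by `e^{i_φ}` -/

section Conjugate

variable {E : Type*} [NormedAddCommGroup E] [NormedSpace ℂ E]
variable {X : Type*} [TopologicalSpace X] [ChartedSpace E X] [IsManifold 𝓘(ℂ, E) ω X]
variable {m k : ℕ}

/-- The operator `i_φ` on families. -/
def contrFam (k : ℕ) (φ : (Fin m →₀ ℕ) → Beltrami E X) :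
    Module.End ℂ ((Fin m →₀ ℕ) → Form E X k) := conv fun ν => contr (φ ν)

/-- The coefficients of `[d, i_φ]`. -/
def dContrCoeff (k : ℕ) (φ : (Fin m →₀ ℕ) → Beltrami E X) (ν : Fin m →₀ ℕ) :
    Form E X k →ₗ[ℂ] Form E X (k + 1) := dContr (φ ν)

/-- The coefficients of `[[d, i_φ], i_φ]`. -/
def dContrTwoCoeff (k : ℕ) (φ : (Fin m →₀ ℕ) → Beltrami E X) (ν : Fin m →₀ ℕ) :
    Form E X k →ₗ[ℂ] Form E X (k + 1) :=
  ∑ x ∈ Finset.HasAntidiagonal.antidiagonal ν, dContrTwo (φ x.1) (φ x.2)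

theorem contr_zero_left : contr (0 : Beltrami E X) = (0 : Form E X k →ₗ[ℂ] Form E X k) := by
  ext1 η
  refine Form.ext fun e y => ?_
  change contrL (η.loc e y) 0 = 0
  rw [map_zero]

theorem expContr_eq_expTrunc (φ : (Fin m →₀ ℕ) → Beltrami E X) (α : (Fin m →₀ ℕ) → Form E X k)
    (ν : Fin m →₀ ℕ) : expContr φ α ν = expTrunc (contrFam k φ) (ν.degree + 1) α ν := by
  rw [expTrunc_apply]
  refine Finset.sum_congr rfl fun j _ => ?_
  rw [Module.End.pow_apply]
  rfl

variable (φ : (Fin m →₀ ℕ) → Beltrami E X)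

theorem dForm_contrFam (α : (Fin m →₀ ℕ) → Form E X k) :
    dForm.compLeft _ (contrFam k φ α) =
      contrFam (k + 1) φ (dForm.compLeft _ α) + conv (dContrCoeff k φ) α := by
  funext ν
  simp only [LinearMap.compLeft_apply, contrFam, Pi.add_apply, Function.comp_apply, conv_apply,
    map_sum, ← Finset.sum_add_distrib]
  refine Finset.sum_congr rfl fun x _ => ?_
  rw [dContrCoeff, dContr, LinearMap.sub_apply, LinearMap.comp_apply, LinearMap.comp_apply]
  abel

theorem dContrCoeff_contrFam (α : (Fin m →₀ ℕ) → Form E X k) :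
    conv (dContrCoeff k φ) (contrFam k φ α) =
      contrFam (k + 1) φ (conv (dContrCoeff k φ) α) + conv (dContrTwoCoeff k φ) α := by
  rw [contrFam, contrFam, conv_conv, conv_conv]
  funext ν
  simp only [Pi.add_apply, conv_apply, ← Finset.sum_add_distrib]
  refine Finset.sum_congr rfl fun x _ => ?_
  rw [← LinearMap.add_apply]
  congr 1
  -- Relabelling the pair in one of the products makes the two sums combine termwise into double
  -- commutators.
  rw [← sum_antidiagonal_swap x.1 (fun a b => contr (φ a) ∘ₗ dContrCoeff k φ b), dContrTwoCoeff,
    ← Finset.sum_add_distrib]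
  refine Finset.sum_congr rfl fun z _ => ?_
  rw [dContrTwo, dContrCoeff]
  abel

theorem dContrTwoCoeff_contrFam (α : (Fin m →₀ ℕ) → Form E X k) :
    conv (dContrTwoCoeff k φ) (contrFam k φ α) =
      contrFam (k + 1) φ (conv (dContrTwoCoeff k φ) α) := by
  rw [contrFam, contrFam, conv_conv, conv_conv]
  congr 2
  funext ν
  rw [← sum_antidiagonal_swap ν (fun a b => contr (φ a) ∘ₗ dContrTwoCoeff k φ b)]
  refine Finset.sum_congr rfl fun z _ => ?_
  ext1 η
  simp only [dContrTwoCoeff, LinearMap.comp_apply, LinearMap.sum_apply, map_sum, dContrTwo_contr]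

/-- The operator `e^{-i_φ} d e^{i_φ} = d + [d, i_φ] + ½ [[d, i_φ], i_φ]` on families. -/
def conjD (k : ℕ) :
    ((Fin m →₀ ℕ) → Form E X k) →ₗ[ℂ] ((Fin m →₀ ℕ) → Form E X (k + 1)) :=
  dForm.compLeft _ + conv (dContrCoeff k φ) + (1 / 2 : ℂ) • conv (dContrTwoCoeff k φ)

variable {φ}

theorem dForm_expContr (hφ : φ 0 = 0) (α : (Fin m →₀ ℕ) → Form E X k) (ν : Fin m →₀ ℕ) :
    dForm (expContr φ α ν) = expContr φ (conjD φ k α) ν := by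
  have hθ : ∀ l : ℕ, (contr (φ 0) : Form E X l →ₗ[ℂ] Form E X l) = 0 := fun l => by
    rw [hφ, contr_zero_left]
  -- With this truncation index even the shortest of the three exponentials contains every term that
  -- is nonzero in degree `|ν|`.
  have h := congrFun (apply_expTrunc (dForm_contrFam φ) (dContrCoeff_contrFam φ)
    (dContrTwoCoeff_contrFam φ) (ν.degree + 1) α) ν
  have e : ∀ (l : ℕ) (β : (Fin m →₀ ℕ) → Form E X l) (M : ℕ), ν.degree < M →
      expTrunc (contrFam l φ) M β ν = expContr φ β ν := fun l β M hM => by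
    rw [expContr_eq_expTrunc]
    exact expTrunc_conv_eq_of_lt (hθ l) β ν hM
  rw [Pi.add_apply, Pi.add_apply, Pi.smul_apply, e _ _ _ (by omega), e _ _ _ (by omega),
    e _ _ _ (by omega), LinearMap.compLeft_apply, Function.comp_apply, e _ _ _ (by omega)] at h
  rw [h]
  simp only [expContr_eq_expTrunc, conjD, LinearMap.add_apply, LinearMap.smul_apply, map_add,
    map_smul, Pi.add_apply, Pi.smul_apply]

/-- The Maurer-Cartan equation makes the antilinear part of the derivative of `φ` minus half the
bracket a symmetric bilinear map, and contraction with it vanishes. Only the `∂φ` part survives. -/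
theorem contrTwo_integrable {N : ℕ} (hint : IsIntegrableUpTo N φ) {ν : Fin m →₀ ℕ}
    (hν : ν.degree ≤ N) {e : atlas E X} {y : E} (hy : y ∈ e.1.target)
    (η : E [⋀^Fin k]→L[ℝ] ℂ) :
    contrTwo (fderiv ℝ ((φ ν).1 e) y) η -
      (1 / 2 : ℂ) • ∑ x ∈ Finset.HasAntidiagonal.antidiagonal ν,
        contrTwo (bracketPt (φ x.1) (φ x.2) e y) η =
      contrTwo (linPart (fderiv ℝ ((φ ν).1 e) y)) η := by
  have hz : contrTwo (antiPart (fderiv ℝ ((φ ν).1 e) y) + -((1 / 2 : ℂ) •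
      ∑ x ∈ Finset.HasAntidiagonal.antidiagonal ν, bracketPt (φ x.1) (φ x.2) e y)) η = 0 := by
    refine contrTwo_of_symmetric (fun v w => ?_) η
    have h := hint ν hν e y hy v w
    have hb : ∀ A B : Beltrami E X, bracketVec (A.1 e) (B.1 e) y v w =
        bracketPt A B e y v w - bracketPt A B e y w v := by
      intro A B
      have : bracketVec (A.1 e) (B.1 e) y v w = linPart (fderiv ℝ (B.1 e) y) (A.1 e y v) w -
        linPart (fderiv ℝ (B.1 e) y) (A.1 e y w) v + (linPart (fderiv ℝ (A.1 e) y) (B.1 e y v) w -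
          linPart (fderiv ℝ (A.1 e) y) (B.1 e y w) v) := rfl
      rw [this]
      simp only [bracketPt, add_apply, ContinuousLinearMap.comp_apply]
      abel
    have hd : dbarVec ((φ ν).1 e) y v w = antiPart (fderiv ℝ ((φ ν).1 e) y) v w -
      antiPart (fderiv ℝ ((φ ν).1 e) y) w v := rfl
    simp only [hd, hb, Finset.sum_sub_distrib, smul_sub] at h
    simp only [add_apply, neg_apply, smul_apply, sum_apply]
    rw [← sub_eq_zero] at h ⊢
    rw [← h]
    abel
  rw [contrTwo_add, contrTwo_neg, contrTwo_smul, contrTwo_sum] at hz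
  conv_lhs => rw [← linPart_add_antiPart (fderiv ℝ ((φ ν).1 e) y), contrTwo_add]
  rw [add_sub_assoc, sub_eq_add_neg, hz, add_zero]

variable [FiniteDimensional ℂ E]

/-- Two terms survive on type `(a, b)`. Contraction with `∂φ` trades a `dz` for a `dz̄` and wins
back a `dz` from the derivative; the derivative of the form along `φ` adds a `dz̄`. Both have type
`(a, b + 1)`. -/
theorem conjCoeff_mem_filt {N : ℕ} (hint : IsIntegrableUpTo N φ) {ν : Fin m →₀ ℕ}
    (hν : ν.degree ≤ N) {p : ℤ} {η : Form E X k} (hη : η ∈ filt E X p k) :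
    dContrCoeff k φ ν η + (1 / 2 : ℂ) • dContrTwoCoeff k φ ν η ∈ filt E X p (k + 1) := by
  -- For `p ≤ 0` there is nothing to prove; for `p > 0` every `a` involved is at least `1`, so it
  -- can lose one in the contraction.
  by_cases hp : p ≤ 0
  · rw [filt_eq_top hp]; exact Submodule.mem_top
  have : filt E X p k ≤ (filt E X p (k + 1)).comap
      (dContrCoeff k φ ν + (1 / 2 : ℂ) • dContrTwoCoeff k φ ν) := by
    refine filt_le_of_bideg fun a b ha ξ hξ => mem_filt_iff.2 fun e y => ?_
    by_cases hy : y ∈ e.1.target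
    swap
    · rw [Form.loc_of_notMem _ e hy]; exact Submodule.zero_mem _
    obtain ⟨a, rfl⟩ : ∃ a', a = a' + 1 := ⟨a - 1, by omega⟩
    have h1 : ((dContrCoeff k φ ν + (1 / 2 : ℂ) • dContrTwoCoeff k φ ν) ξ).loc e y =
        contrTwo (linPart (fderiv ℝ ((φ ν).1 e) y)) (ξ.loc e y) -
          alternatizeUncurryFin (linPart (fderiv ℝ (ξ.loc e) y) ∘L (φ ν).1 e y) := by
      rw [← contrTwo_integrable hint hν hy]
      change locL e y (_ + (1 / 2 : ℂ) • _) = _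
      rw [map_add, map_smul, dContrTwoCoeff, LinearMap.sum_apply, map_sum]
      have h2 : ∀ x : (Fin m →₀ ℕ) × (Fin m →₀ ℕ), locL e y (dContrTwo (φ x.1) (φ x.2) ξ) =
          -contrTwo (bracketPt (φ x.1) (φ x.2) e y) (ξ.loc e y) := fun x =>
        dContrTwo_loc _ _ _ hy
      have h3 : locL e y (dContrCoeff k φ ν ξ) = contrTwo (fderiv ℝ ((φ ν).1 e) y) (ξ.loc e y) -
          alternatizeUncurryFin (linPart (fderiv ℝ (ξ.loc e) y) ∘L (φ ν).1 e y) :=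
        dContr_loc _ _ hy
      simp only [h2, h3, Finset.sum_neg_distrib]
      module
    rw [h1]
    refine Submodule.sub_mem _ ?_ ?_
    · refine HasType.mem_filtPt (HasType.alternatizeUncurryFin_of_linear (a := a) (b := b + 1)
        (fun u => ?_) fun u => ?_) ha
      · rw [ContinuousLinearMap.comp_apply, linPart_I_smul, contrL_smul]; rfl
      · exact (hξ e y).contrPt fun v => Beltrami.linPart_fderiv_map_I_smul (φ ν) hy u v
    · exact HasType.mem_filtPt (HasType.alternatizeUncurryFin_of_antilinear (a := a + 1) (b := b)
        (antilinear_comp (linPart_I_smul _) (Beltrami.map_I_smul (φ ν) e y))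
        fun u => hasType_linPart_fderiv hξ hy _) ha
  exact this hη

theorem conjD_mem_filt {N : ℕ} (hint : IsIntegrableUpTo N φ) {p : ℤ}
    {α : (Fin m →₀ ℕ) → Form E X k} (hα : ∀ ν, α ν ∈ filt E X p k) {ν : Fin m →₀ ℕ}
    (hν : ν.degree ≤ N) : conjD φ k α ν ∈ filt E X p (k + 1) := by
  have : conjD φ k α ν = dForm (α ν) + ∑ x ∈ Finset.HasAntidiagonal.antidiagonal ν,
      (dContrCoeff k φ x.1 (α x.2) + (1 / 2 : ℂ) • dContrTwoCoeff k φ x.1 (α x.2)) := by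
    rw [Finset.sum_add_distrib, ← Finset.smul_sum, ← add_assoc]
    rfl
  rw [this]
  refine Submodule.add_mem _ (dForm_mem_filt (hα ν)) (Submodule.sum_mem _ fun x hx => ?_)
  rw [Finset.HasAntidiagonal.mem_antidiagonal] at hx
  have h2 : x.1.degree + x.2.degree = ν.degree := by rw [← hx, map_add]
  exact conjCoeff_mem_filt hint (by omega) (hα _)

/-- The first obstruction to `d`-closedness of `e^{i_φ} α` lies in the filtration step of `α`. -/
theorem dForm_expContr_mem_filt {N n : ℕ} (hn : n ≤ N) (hφ : φ 0 = 0)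
    (hint : IsIntegrableUpTo N φ) {p : ℤ} {α : (Fin m →₀ ℕ) → Form E X k}
    (hα : ∀ ν, α ν ∈ filt E X p k)
    (hd : ∀ ν : Fin m →₀ ℕ, ν.degree < n → dForm (expContr φ α ν) = 0) {ν : Fin m →₀ ℕ}
    (hν : ν.degree = n) : dForm (expContr φ α ν) ∈ filt E X p (k + 1) := by
  have hθ : (contr (φ 0) : Form E X (k + 1) →ₗ[ℂ] Form E X (k + 1)) = 0 := by
    rw [hφ, contr_zero_left]
  -- Below order `n`, closedness forces `conjD φ k α` to vanish degree by degree, because the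
  -- exponential does not change the lowest-order part. For the same reason it does not change the
  -- order-`n` coefficient used afterwards.
  have hz : ∀ s, s ≤ n → ∀ μ : Fin m →₀ ℕ, μ.degree < s → conjD φ k α μ = 0 := by
    intro s
    induction s with
    | zero => intro _ μ hμ; omega
    | succ s ih =>
      intro hs μ hμ
      have h1 := hd μ (by omega)
      rw [dForm_expContr hφ, expContr_eq_expTrunc] at h1
      rw [← h1]
      exact (expTrunc_conv_of_le (θ := fun ν => contr (φ ν)) hθ (ih (by omega)) μ (by omega) _).symm
  rw [dForm_expContr hφ, expContr_eq_expTrunc]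
  have h2 := expTrunc_conv_of_le (θ := fun ν => contr (φ ν)) hθ (hz n le_rfl) ν hν.le ν.degree
  rw [contrFam, h2]
  exact conjD_mem_filt hint hα (by omega)

end Conjugate

/-! ### Vanishing of the Frölicher differentials -/

section Frolicher

variable {E : Type*} [NormedAddCommGroup E] [NormedSpace ℂ E]
variable {X : Type*} [TopologicalSpace X] [ChartedSpace E X] [IsManifold 𝓘(ℂ, E) ω X]
variable {k : ℕ}

/-- If the class of `dβ` is zero on page `r`, then `dβ` lies in `Z_{r-1}^{s+r+1} + B_{r-1}^{s+r}`.
Elements of the second summand have primitives in `F^{s+1}`, and such a primitive is the correction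
`γ`. -/
theorem exists_dForm_sub_mem_of_frolicherD_eq_zero {r s : ℤ} (hD : frolicherD E X r s k = 0)
    {β : Form E X k} (hβ : β ∈ filt E X s k) (hd : dForm β ∈ filt E X (s + r) (k + 1)) :
    ∃ γ ∈ filt E X (s + 1) k, dForm (β - γ) ∈ filt E X (s + r + 1) (k + 1) := by
  have hZ : β ∈ frolicherZ E X r s k := ⟨hβ, hd⟩
  have h1 : frolicherD E X r s k (Submodule.Quotient.mk ⟨β, hZ⟩) = 0 := by
    rw [hD, LinearMap.zero_apply]
  rw [frolicherD, Submodule.mapQ_apply, Submodule.Quotient.mk_eq_zero] at h1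
  have h2 : dForm β ∈ frolicherZ E X (r - 1) (s + r + 1) (k + 1) ⊔
      frolicherB E X (r - 1) (s + r) (k + 1) := h1
  obtain ⟨z, hz, b, ⟨-, γ, hγ, rfl⟩, hzb⟩ := Submodule.mem_sup.1 h2
  rw [show s + r - (r - 1) = s + 1 by ring] at hγ
  refine ⟨γ, hγ, ?_⟩
  rw [map_sub, ← hzb, add_sub_cancel_right]
  exact hz.1

/-- The corrections are iterated over the pages from `r₀` on. Each pushes `dβ` one filtration step
further, until it leaves the range of nonzero steps. -/
theorem exists_dForm_sub_eq_zero {r₀ s : ℤ} (hD : ∀ r, r₀ ≤ r → frolicherD E X r s k = 0)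
    {β : Form E X k} (hβ : β ∈ filt E X s k) (hd : dForm β ∈ filt E X (s + r₀) (k + 1)) :
    ∃ γ ∈ filt E X (s + 1) k, dForm (β - γ) = 0 := by
  have key : ∀ n : ℕ, ∃ γ ∈ filt E X (s + 1) k,
      dForm (β - γ) ∈ filt E X (s + (r₀ + n)) (k + 1) := by
    intro n
    induction n with
    | zero => exact ⟨0, Submodule.zero_mem _, by simpa using hd⟩
    | succ n ih =>
      obtain ⟨γ, hγ, h⟩ := ih
      obtain ⟨γ', hγ', h'⟩ := exists_dForm_sub_mem_of_frolicherD_eq_zero (hD (r₀ + n) (by omega))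
        (Submodule.sub_mem _ hβ (filt_anti (by omega) hγ)) h
      refine ⟨γ + γ', Submodule.add_mem _ hγ hγ', ?_⟩
      rw [← sub_sub, show s + (r₀ + ((n + 1 : ℕ) : ℤ)) = s + (r₀ + n) + 1 by push_cast; ring]
      exact h'
  -- This many steps reach filtration index at least `k + 2`, where `F` is zero on `(k+1)`-forms.
  obtain ⟨γ, hγ, h⟩ := key (k + 2 - (s + r₀)).toNat
  exact ⟨γ, hγ, eq_zero_of_mem_filt (by push_cast; omega) h⟩

/-- If no differential hits the step `F^p`, then `d` is strict there. -/
theorem exists_dForm_eq_of_mem_filt [FiniteDimensional ℂ E] {p : ℕ}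
    (hadj : ∀ r i : ℤ, 1 ≤ r → 0 ≤ i → i ≤ r - 1 → frolicherD E X r (p - 1 - i) k = 0)
    {β : Form E X k} (hd : dForm β ∈ filt E X p (k + 1)) :
    ∃ γ ∈ filt E X p k, dForm γ = dForm β := by
  have key : ∀ n : ℕ, ∀ β : Form E X k, β ∈ filt E X (p - n) k →
      dForm β ∈ filt E X p (k + 1) → ∃ γ ∈ filt E X p k, dForm γ = dForm β := by
    intro n
    induction n with
    | zero => intro β hβ _; exact ⟨β, by simpa using hβ, rfl⟩
    | succ n ih =>
      intro β hβ hd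
      rw [show (p : ℤ) - ((n + 1 : ℕ) : ℤ) = p - 1 - n by push_cast; ring] at hβ
      -- From step `p - 1 - n`, membership of `dβ` in `F^p` is a jump by `n + 1`, so exactly the
      -- pages `r ≥ n + 1` are needed. The correction `γ` has the same derivative as `β` and lies
      -- one step higher, so it replaces `β`.
      obtain ⟨γ, hγ, h⟩ := exists_dForm_sub_eq_zero (r₀ := n + 1)
        (fun r hr => hadj r n (by omega) (by omega) (by omega)) hβ
        (by rw [show (p : ℤ) - 1 - n + (n + 1) = p by ring]; exact hd)
      rw [map_sub, sub_eq_zero] at h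
      rw [show (p : ℤ) - 1 - n + 1 = p - n by ring] at hγ
      rw [h] at hd ⊢
      exact ih γ hγ hd
  -- The climb starts from `F^0`, which contains all forms, and takes `p` steps.
  refine key p β ?_ hd
  rw [filt_eq_top (by omega)]
  exact Submodule.mem_top

end Frolicher

/-! ### Solving the equation order by order in `t` -/

section Extension

variable {E : Type*} [NormedAddCommGroup E] [NormedSpace ℂ E]
variable {X : Type*} [TopologicalSpace X] [ChartedSpace E X] [IsManifold 𝓘(ℂ, E) ω X]

/-- A correction that starts at order `n` affects the exponential, up to that order, only by being
subtracted itself. -/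
theorem expContr_sub_single {m k : ℕ} {φ : (Fin m →₀ ℕ) → Beltrami E X} (hφ : φ 0 = 0) {n : ℕ}
    (α γ : (Fin m →₀ ℕ) → Form E X k) (hγ : ∀ ν, ν.degree < n → γ ν = 0) {ν : Fin m →₀ ℕ}
    (hν : ν.degree ≤ n) : expContr φ (α - γ) ν = expContr φ α ν - γ ν := by
  have hθ : (contr (φ 0) : Form E X k →ₗ[ℂ] Form E X k) = 0 := by rw [hφ, contr_zero_left]
  simp only [expContr_eq_expTrunc, map_sub, Pi.sub_apply]
  congr 1
  exact expTrunc_conv_of_le hθ hγ ν hν _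

variable [FiniteDimensional ℂ E]

theorem exists_closed_extension (p q : ℕ)
    (hpq : ∀ r : ℤ, 1 ≤ r → frolicherD E X r p (p + q) = 0)
    (hadj : ∀ r i : ℤ, 1 ≤ r → 0 ≤ i → i ≤ r - 1 → frolicherD E X r (p - 1 - i) (p + q) = 0)
    {m N : ℕ} {φ : (Fin m →₀ ℕ) → Beltrami E X} (hφ : φ 0 = 0) (hint : IsIntegrableUpTo N φ)
    {α₀ : Form E X (p + q)} (hα₀ : α₀ ∈ bideg E X p q (p + q)) (hclosed : dbar α₀ = 0)
    (n : ℕ) (hn : n ≤ N) :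
    ∃ α : (Fin m →₀ ℕ) → Form E X (p + q), (∀ ν, α ν ∈ filt E X p (p + q)) ∧
      (∀ ν, n < ν.degree → α ν = 0) ∧ (∀ ν, ν.degree ≤ n → dForm (expContr φ α ν) = 0) ∧
      component p q (α 0) = α₀ := by
  classical
  induction n with
  | zero =>
    have hp := bideg_le_filt le_rfl hα₀
    -- Since `∂̄α₀ = 0`, the form `dα₀` already lies in `F^{p+1}`, so the corrections start at page
    -- `1`. They lie in `F^{p+1}` and do not touch the `(p, q)`-component.
    obtain ⟨γ, hγ, hd⟩ := exists_dForm_sub_eq_zero (r₀ := 1) hpq hp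
      (dForm_mem_filt_of_dbar_eq_zero hα₀ hclosed)
    refine ⟨Pi.single 0 (α₀ - γ), fun ν => ?_, fun ν hν => ?_, fun ν hν => ?_, ?_⟩
    · by_cases h : ν = 0
      · subst h
        rw [Pi.single_eq_same]
        exact Submodule.sub_mem _ hp (filt_anti (by omega) hγ)
      · rw [Pi.single_eq_of_ne h]; exact Submodule.zero_mem _
    · refine Pi.single_eq_of_ne ?_ _
      rintro rfl
      simp at hν
    · obtain rfl : ν = 0 := (Finsupp.degree_eq_zero_iff ν).1 (by omega)
      have h1 := expTrunc_conv_of_le (θ := fun ν => (contr (φ ν) : Form E X (p + q) →ₗ[ℂ] _))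
        (by rw [hφ, contr_zero_left]) (n := 0) (α := Pi.single 0 (α₀ - γ)) (by simp) 0 (by simp)
        (0 : Fin m →₀ ℕ).degree
      rw [expContr_eq_expTrunc, contrFam, h1, Pi.single_eq_same, hd]
    · rw [Pi.single_eq_same, map_sub, component_of_mem_bideg rfl hα₀,
        component_eq_zero_of_mem_filt (by omega) hγ, sub_zero]
  | succ n ih =>
    obtain ⟨α, h1, h2, h3, h4⟩ := ih (by omega)
    -- The obstruction in degree `n + 1` is exact and lies in `F^p`; strictness of `d` gives it a
    -- primitive in `F^p`.
    have h5 : ∀ ν : Fin m →₀ ℕ, ν.degree = n + 1 →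
        ∃ γ ∈ filt E X p (p + q), dForm γ = dForm (expContr φ α ν) := fun ν hν =>
      exists_dForm_eq_of_mem_filt hadj (dForm_expContr_mem_filt hn hφ hint h1
        (fun μ hμ => h3 μ (by omega)) hν)
    choose! γ hγ hdγ using h5
    -- The correction is homogeneous of degree `n + 1 ≥ 1`, so lower orders and `α 0` are kept.
    let δ : (Fin m →₀ ℕ) → Form E X (p + q) := fun ν => if ν.degree = n + 1 then γ ν else 0
    have hδ : ∀ ν, ν.degree < n + 1 → δ ν = 0 := fun ν hν => if_neg (by omega)
    refine ⟨α - δ, fun ν => Submodule.sub_mem _ (h1 ν) ?_, fun ν hν => ?_, fun ν hν => ?_, ?_⟩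
    · by_cases h : ν.degree = n + 1
      · simp only [δ, if_pos h]; exact hγ ν h
      · simp only [δ, if_neg h]; exact Submodule.zero_mem _
    · have : δ ν = 0 := if_neg (by omega)
      rw [Pi.sub_apply, h2 ν (by omega), this, sub_zero]
    · rw [expContr_sub_single hφ α δ hδ hν, map_sub]
      by_cases h : ν.degree = n + 1
      · simp only [δ, if_pos h]
        rw [hdγ ν h, sub_self]
      · rw [h3 ν (by omega), hδ ν (by omega), map_zero, sub_zero]
    · rw [Pi.sub_apply, hδ 0 (by simp), sub_zero, h4]

end Extension

end CplxForms

end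

theorem mainTheorem4
    {E : Type*} [NormedAddCommGroup E] [NormedSpace ℂ E] [FiniteDimensional ℂ E]
    {X : Type*} [TopologicalSpace X] [ChartedSpace E X] [IsManifold 𝓘(ℂ, E) ω X]
    [T2Space X] [CompactSpace X]
    (p q : ℕ)
    (hpq : ∀ r : ℤ, 1 ≤ r → CplxForms.frolicherD E X r p (p + q) = 0)
    (hadj : ∀ r i : ℤ, 1 ≤ r → 0 ≤ i → i ≤ r - 1 →
      CplxForms.frolicherD E X r (p - 1 - i) (p + q) = 0)
    (m N : ℕ) (φ : (Fin m →₀ ℕ) → CplxForms.Beltrami E X)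
    (hφ : ∀ ν, φ ν ≠ 0 → 1 ≤ ν.degree ∧ ν.degree ≤ N)
    (hint : CplxForms.IsIntegrableUpTo N φ)
    (α₀ : CplxForms.Form E X (p + q)) (hα₀ : α₀ ∈ CplxForms.bideg E X p q (p + q))
    (hclosed : CplxForms.dbar α₀ = 0) :
    ∃ α : (Fin m →₀ ℕ) → CplxForms.Form E X (p + q),
      (∀ ν, α ν ∈ CplxForms.filt E X p (p + q)) ∧
      (∀ ν, N < ν.degree → α ν = 0) ∧
      (∀ ν, ν.degree ≤ N → CplxForms.dForm (CplxForms.expContr φ α ν) = 0) ∧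
      CplxForms.component p q (α 0) = α₀ := by
  have hφ0 : φ 0 = 0 := by
    by_contra h
    have := (hφ 0 h).1
    simp at this
  exact CplxForms.exists_closed_extension p q hpq hadj hφ0 hint hα₀ hclosed N le_rfl
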